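/- Let $(W,S)$ be a Coxeter system with $S=\{s_i\}_{i\in I}$ finite, and let $m_{ij}\in\{2,3,\dots\}\cup\{\infty\}$ be the order of $s_is_j$ for $i\neq j$. The *defining diagram* of $(W,S)$ is the graph with vertex set $S$ in which $s_i\ne s_j$ are joined by an edge, labelled $m_{ij}$, if and only if $m_{ij}<\infty$. It is *flexible* if there are a vertex $s\in S$ and a nontrivial label-preserving automorphism of the diagram that fixes $s$ and every vertex joined to $s$ by an edge. Let $\Gamma=\Gamma(W,S)$ be the Cayley graph: its vertex set is $W$, and $w$ and $ws$ are joined by an edge for all $w\in W$, $s\in S$. Let $\mathrm{Aut}(\Gamma)$ be its group of graph automorphisms (not required to preserve the labelling of the edges by $S$). Left-multiplication automorphisms of $\Gamma$ are the maps $x\mapsto wx$ with $w\in W$; diagram automorphisms of $\Gamma$ are the maps given by the group automorphisms of $W$ that extend the permutations $\varphi$ of $S$ with $m_{\varphi(s)\varphi(t)}=m_{st}$ for all $s,t\in S$. For $T\subseteq S$ let $W_T=\langle T\rangle$; $T$ is *spherical* if $W_T$ is finite. The Davis complex $\Sigma=\Sigma(W,S)$ is the simplicial complex whose vertices are the cosets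 $wW_T$ ($w\in W$, $T\subseteq S$ spherical) and whose simplices are the nonempty finite chains of such cosets under inclusion. For $w\in W$ the chamber $wK$ is the full subcomplex spanned by the vertices $wW_T$, $T$ spherical. Let $\mathrm{Aut}(\Sigma)$ be the group of simplicial automorphisms of $\Sigma$ that permute the chambers, with the topology in which the pointwise stabilizers of finite sets of vertices form a basis of neighbourhoods of the identity. Then every $g\in\mathrm{Aut}(\Gamma)$ induces an automorphism of $\Sigma$, sending each vertex $C\subseteq W$ of $\Sigma$ to its image $g(C)$, and this defines a group isomorphism $$\mathrm{Aut}(\Gamma)\;\cong\;\mathrm{Aut}(\Sigma).$$ Call the automorphisms of $\Sigma$ induced by left-multiplication (respectively diagram) automorphisms of $\Gamma$ the left-multiplication (respectively diagram) automorphisms of $\Sigma$, and let $L$ and $D$ be the subgroups of $\mathrm{Aut}(\Sigma)$ formed by them. Then: 1. every element of $\mathrm{Aut}(\Sigma)$ is the composition of a left-multiplication automorphism and a diagram automorphism of $\Sigma$ if and only if the defining diagram of $(W,S)$ is not flexible; 2. $\mathrm{Aut}(\Sigma)$ is a discrete group if and only if the defining diagram of $(W,S)$ is not flexible; 3. the defining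 diagram of $(W,S)$ is not flexible if and only if $\mathrm{Aut}(\Sigma)$ is the (internal) semidirect product $L\rtimes D$, that is, $L$ is normal, $L\cap D=1$ and $LD=\mathrm{Aut}(\Sigma)$. -/

import Mathlib

open scoped Pointwise

namespace CoxeterMatrix

variable {B : Type*} (M : CoxeterMatrix B)

/-- The defining diagram: vertices are (the indices of) the generators, and two distinct generators
are joined if and only if the corresponding entry `m` of the Coxeter matrix is finite
(Mathlib writes `0` for `∞`). The edge between `i` and `j` carries the label `M i j`. -/
def definingDiagram : SimpleGraph B where
  Adj i j := i ≠ j ∧ M i j ≠ 0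
  symm := ⟨fun i j h => ⟨h.1.symm, by rw [M.symmetric j i]; exact h.2⟩⟩
  loopless := ⟨fun _ h => h.1 rfl⟩

/-- The automorphism group of the labelled diagram: the permutations of the generators that preserve
all the numbers `m i j` (including the value `∞`). Since the Coxeter diagram and the defining diagram
both record exactly these numbers, they have the same label-preserving automorphisms. -/
def diagramAut : Subgroup (Equiv.Perm B) where
  carrier := {φ | ∀ i j, M (φ i) (φ j) = M i j}
  one_mem' := fun _ _ => rfl
  mul_mem' := fun {φ ψ} hφ hψ i j => by
    rw [Equiv.Perm.mul_apply, Equiv.Perm.mul_apply, hφ, hψ]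
  inv_mem' := fun {φ} hφ i j => by
    rw [← hφ (φ⁻¹ i) (φ⁻¹ j)]
    simp

/-- The defining diagram is flexible if some nontrivial label-preserving automorphism of it
fixes a vertex `s` and all the vertices joined to `s` by an edge. -/
def IsFlexible : Prop :=
  ∃ s : B, ∃ φ ∈ M.diagramAut, φ ≠ 1 ∧ φ s = s ∧ ∀ t, M.definingDiagram.Adj s t → φ t = t

end CoxeterMatrix

namespace CoxeterSystem

variable {B W : Type*} [Group W] {M : CoxeterMatrix B} (cs : CoxeterSystem M W)

/-! ### The Cayley graph and its automorphisms -/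

/-- The (undirected) Cayley graph `Γ(W, S)`: `w` is joined to `w * s` for every generator `s`. -/
def cayleyGraph : SimpleGraph W where
  Adj w w' := ∃ i, w' = w * cs.simple i
  symm := ⟨by
    rintro w _ ⟨i, rfl⟩
    exact ⟨i, by rw [cs.simple_mul_simple_cancel_right]⟩⟩
  loopless := ⟨by
    rintro w ⟨i, hi⟩
    have h1 : cs.simple i = 1 := by simpa using hi
    have h2 := cs.length_simple i
    rw [h1, cs.length_one] at h2
    exact zero_ne_one h2⟩

/-- The group of graph automorphisms of `Γ(W, S)`; edge labels need not be preserved. -/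
abbrev CayleyAut : Type _ := cs.cayleyGraph ≃g cs.cayleyGraph

/-- The left-multiplication automorphisms `x ↦ w * x` of the Cayley graph. -/
def cayleyLeftMul : Subgroup cs.CayleyAut where
  carrier := {g | ∃ w : W, ∀ x, g x = w * x}
  one_mem' := ⟨1, fun x => (one_mul x).symm⟩
  mul_mem' := by
    rintro g h ⟨u, hu⟩ ⟨v, hv⟩
    exact ⟨u * v, fun x => by rw [RelIso.mul_apply, hv, hu, mul_assoc]⟩
  inv_mem' := by
    rintro g ⟨u, hu⟩
    refine ⟨u⁻¹, fun x => g.injective ?_⟩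
    rw [RelIso.apply_inv_self, hu, mul_inv_cancel_left]

/-- The diagram automorphisms of the Cayley graph: an automorphism `φ` of the diagram induces the
group automorphism `α` of `W` with `α (s i) = s (φ i)`, which acts on the vertices of the graph. -/
def cayleyDiagram : Subgroup cs.CayleyAut where
  carrier := {g | ∃ φ ∈ M.diagramAut, ∃ α : W ≃* W,
    (∀ i, α (cs.simple i) = cs.simple (φ i)) ∧ ∀ x, g x = α x}
  one_mem' := ⟨1, one_mem _, MulEquiv.refl W, fun _ => rfl, fun _ => rfl⟩
  mul_mem' := by
    rintro g h ⟨φ, hφ, α, hα, hg⟩ ⟨ψ, hψ, β, hβ, hh⟩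
    refine ⟨φ * ψ, mul_mem hφ hψ, β.trans α, fun i => ?_, fun x => ?_⟩
    · rw [MulEquiv.trans_apply, hβ, hα, Equiv.Perm.mul_apply]
    · rw [RelIso.mul_apply, hh, hg, MulEquiv.trans_apply]
  inv_mem' := by
    rintro g ⟨φ, hφ, α, hα, hg⟩
    refine ⟨φ⁻¹, inv_mem hφ, α.symm, fun i => ?_, fun x => g.injective ?_⟩
    · rw [MulEquiv.symm_apply_eq, hα]
      simp
    · rw [RelIso.apply_inv_self, hg, MulEquiv.apply_symm_apply]

/-! ### The Davis complex -/

/-- The special subgroup `W_T` generated by a set `T` of generators. -/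
def specialSubgroup (T : Set B) : Subgroup W := Subgroup.closure (cs.simple '' T)

/-- The set `T` of generators is spherical if `W_T` is finite. -/
def IsSpherical (T : Set B) : Prop := (cs.specialSubgroup T : Set W).Finite

/-- The spherical cosets `w W_T` (`w ∈ W`, `T` spherical). As subsets of `W` they are partially
ordered by inclusion. -/
abbrev SphericalCoset : Type _ :=
  {C : Set W // ∃ (w : W) (T : Set B), cs.IsSpherical T ∧ C = w • (cs.specialSubgroup T : Set W)}

/-- The Davis complex `Σ(W, S)`, as the simplicial complex of the poset of spherical cosets:
its vertices are the spherical cosets and its simplices are the finite nonempty chains. -/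
def davisComplex : AbstractSimplicialComplex cs.SphericalCoset where
  faces := {σ | σ.Nonempty ∧ IsChain (· ≤ ·) (σ : Set cs.SphericalCoset)}
  isRelLowerSet_faces := fun _ hσ =>
    ⟨hσ.1, fun _ hτ hne => ⟨hne, hσ.2.mono (Finset.coe_subset.2 hτ)⟩⟩
  singleton_mem := fun v => ⟨Finset.singleton_nonempty v, by simp [IsChain]⟩

/-- The chamber `wK` of the Davis complex. It is the full subcomplex spanned by the spherical cosets
`w W_T`, that is, by those containing `w`, and is recorded through its set of vertices.
The mirror of `wK` of type `s` is spanned by the `w W_T` with `s ∈ T`, and the chambers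
`wK` and `(w * s)K` meet in this mirror. -/
def chamber (w : W) : Set cs.SphericalCoset := {v | w ∈ (v : Set W)}

/-- The automorphism group of the Davis complex: the simplicial automorphisms (the bijections of the
vertices which preserve the simplices, in both directions) which permute the chambers. -/
def davisAut : Subgroup (Equiv.Perm cs.SphericalCoset) where
  carrier := {f |
    (∀ σ : Finset cs.SphericalCoset,
      σ.map f.toEmbedding ∈ cs.davisComplex ↔ σ ∈ cs.davisComplex) ∧
    ∀ A : Set cs.SphericalCoset, f '' A ∈ Set.range cs.chamber ↔ A ∈ Set.range cs.chamber}
  one_mem' := by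
    refine ⟨fun σ => ?_, fun A => ?_⟩
    · rw [show (1 : Equiv.Perm cs.SphericalCoset).toEmbedding = Function.Embedding.refl _ from rfl,
        Finset.map_refl]
    · rw [Equiv.Perm.coe_one, Set.image_id]
  mul_mem' := by
    rintro f g ⟨hf, hf'⟩ ⟨hg, hg'⟩
    refine ⟨fun σ => ?_, fun A => ?_⟩
    · rw [← hg σ, ← hf (σ.map g.toEmbedding), Finset.map_map]
      rfl
    · rw [← hg' A, ← hf' (g '' A), Set.image_image]
      rfl
  inv_mem' := by
    rintro f ⟨hf, hf'⟩
    refine ⟨fun σ => ?_, fun A => ?_⟩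
    · rw [← hf, Finset.map_map]
      have : (f⁻¹ : Equiv.Perm _).toEmbedding.trans f.toEmbedding
          = Function.Embedding.refl _ := by
        ext1 v
        exact f.apply_symm_apply v
      rw [this, Finset.map_refl]
    · rw [← hf', Set.image_image]
      simp

/-- The group `Aut(Σ)`. -/
abbrev DavisAut : Type _ := cs.davisAut

/-- The usual topology on `Aut(Σ)`, in which the pointwise stabilizers of finite sets of vertices form
a basis of neighbourhoods of the identity: the topology of pointwise convergence on the (discrete) set
of vertices. For finite `S` the complex is locally finite, and this is the compact-open topology. -/
instance : TopologicalSpace cs.DavisAut :=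
  TopologicalSpace.induced (fun f v => (f : Equiv.Perm cs.SphericalCoset) v)
    (@Pi.topologicalSpace cs.SphericalCoset (fun _ => cs.SphericalCoset) fun _ => ⊥)

/-- The automorphism `g` of the Cayley graph (whose vertices are the elements of `W`) induces the
automorphism `f` of the Davis complex: `f` sends each spherical coset to its image under `g`. -/
def Induces {cs : CoxeterSystem M W} (g : cs.CayleyAut) (f : cs.DavisAut) : Prop :=
  ∀ v : cs.SphericalCoset, ((f : Equiv.Perm cs.SphericalCoset) v : Set W) = g '' (v : Set W)

/-- The automorphisms of the Davis complex induced by the members of a subgroup `H` of `Aut(Γ)`. -/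
def inducedSubgroup (H : Subgroup cs.CayleyAut) : Subgroup cs.DavisAut where
  carrier := {f | ∃ g ∈ H, Induces g f}
  one_mem' := ⟨1, one_mem _, fun v => (Set.image_id (v : Set W)).symm⟩
  mul_mem' := by
    rintro f f' ⟨g, hg, h⟩ ⟨g', hg', h'⟩
    refine ⟨g * g', mul_mem hg hg', fun v => ?_⟩
    rw [RelIso.coe_mul, Set.image_comp, ← h' v, ← h]
    rfl
  inv_mem' := by
    rintro f ⟨g, hg, h⟩
    refine ⟨g⁻¹, inv_mem hg, fun v => g.injective.image_injective ?_⟩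
    rw [← h, ← Set.image_comp, ← RelIso.coe_mul, mul_inv_cancel, RelIso.coe_one, Set.image_id,
      Subgroup.coe_inv]
    simp

/-- The left-multiplication automorphisms of the Davis complex. -/
def davisLeftMul : Subgroup cs.DavisAut := cs.inducedSubgroup cs.cayleyLeftMul

/-- The diagram automorphisms of the Davis complex. -/
def davisDiagram : Subgroup cs.DavisAut := cs.inducedSubgroup cs.cayleyDiagram

end CoxeterSystem

/-! Everything about a Cayley graph automorphism `g` is read off the word metric, which `g`
preserves. That `i` is a left descent of `v⁻¹ * w` says that the neighbour `v * s i` of `v` is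
nearer to `w`. Sphericity of `T`, and membership in a spherical `W_T`, can be phrased through
descents and lengths alone (`isSpherical_iff`, `IsSpherical.mem_specialSubgroup_iff`). So `g` maps
spherical cosets to spherical cosets and acts on the Davis complex. Conversely, an automorphism of
the complex permutes the chambers, hence the elements of `W`, and it preserves edges because these
are the two-element spherical cosets.

At each vertex `v`, `g` permutes the labels of the outgoing edges by `localPerm g v`, which is a
diagram automorphism. Crossing an `i`-edge does not change its value at `i` or at any `j` with `m i
j` finite, since `g` maps dihedral cosets to dihedral cosets. Without flexibility `localPerm` is
therefore constant, and `g` is a left multiplication after a diagram automorphism. Such maps are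
determined by their values on `1` and the generators, whence discreteness.

If a nontrivial `φ` fixes `s` and its neighbours, apply `φ` on the link chamber of `s` and the
identity elsewhere. This twist is a graph automorphism because an edge leaving the link chamber
starts in the subgroup of the link (`mem_specialSubgroup_of_linkChamber_boundary`), which `φ` fixes
pointwise. It is not standard, and translates of it fix arbitrarily large balls, so the group is not
discrete.

The Coxeter group theory rests on two classical tools: the geometric representation, for the orders
of `s i * s j` and for deciding which generators lie in `W_T`, and the exchange property. -/

namespace CoxeterMatrix

open Real Polynomial.Chebyshev

variable {B : Type*} (M : CoxeterMatrix B)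

/-! ### The geometric representation -/

/-- The linear form `2 B(α i, ·)` of the geometric representation. -/
noncomputable def geomForm (i : B) : Module.Dual ℝ (B →₀ ℝ) :=
  -- For `m = ∞`, encoded as `0`, the convention `π / 0 = 0` yields the usual coefficient `-2`.
  Finsupp.linearCombination ℝ fun j => -2 * cos (π / M i j)

theorem geomForm_single (i j : B) :
    M.geomForm i (Finsupp.single j 1) = -2 * cos (π / M i j) := by
  simp [geomForm]

theorem geomForm_single_self (i : B) : M.geomForm i (Finsupp.single i 1) = 2 := by
  simp [geomForm_single]

/-- The reflections of the geometric representation. -/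
noncomputable def geomReflection (i : B) : (B →₀ ℝ) ≃ₗ[ℝ] (B →₀ ℝ) :=
  Module.reflection (M.geomForm_single_self i)

theorem geomReflection_apply (i : B) (v : B →₀ ℝ) :
    M.geomReflection i v = v - M.geomForm i v • Finsupp.single i 1 :=
  Module.reflection_apply _ _

theorem geomForm_mul_geomForm (i j : B) :
    M.geomForm i (Finsupp.single j 1) * M.geomForm j (Finsupp.single i 1) - 2
      = 2 * cos (2 * (π / M i j)) := by
  rw [geomForm_single, geomForm_single, M.symmetric j i, cos_two_mul]
  ring

/-- The rotation angle `2π/m` lies strictly between `0` and `π` only for `m ≥ 3`; this is why `m =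
2` and `m = ∞` are treated apart below. -/
theorem sin_two_mul_pi_div_ne_zero {m : ℕ} (hm : 3 ≤ m) : sin (2 * (π / m)) ≠ 0 := by
  have h3 : (3 : ℝ) ≤ m := by exact_mod_cast hm
  refine (sin_pos_of_pos_of_lt_pi (by positivity) ?_).ne'
  rw [← mul_div_assoc, div_lt_iff₀ (by positivity)]
  nlinarith [pi_pos]

theorem eval_S_two_mul_cos (θ : ℝ) (hθ : sin θ ≠ 0) (n : ℤ) :
    (S ℝ n).eval (2 * cos θ) = sin ((n + 1) * θ) / sin θ := by
  rw [eq_div_iff hθ, S_two_mul_real_cos]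

/-- Powers of a product of two reflections have Chebyshev polynomials at `2 cos (2π/m)` as
coefficients, and these are quotients of sines. At the exponent `m` the relevant factor vanishes:
`S_{k-1}` for `m = 2k`, and `S_k + S_{k-1}` for `m = 2k + 1`. -/
theorem geomReflection_liftable : M.IsLiftable M.geomReflection := by
  intro i j
  by_cases hij : i = j
  · subst hij
    rw [M.diagonal, pow_one]
    ext1 v
    exact Module.involutive_reflection (M.geomForm_single_self i) v
  rcases Nat.lt_or_ge (M i j) 3 with hm | hm
  · have h1 := M.off_diagonal i j hij
    obtain h | h : M i j = 0 ∨ M i j = 2 := by omega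
    · rw [h, pow_zero]
    · have h' : M j i = 2 := by rw [M.symmetric, h]
      rw [h, pow_two]
      apply LinearEquiv.ext
      intro v
      have hc : cos (π / (2 : ℕ)) = 0 := by rw [Nat.cast_two, cos_pi_div_two]
      have e1 : M.geomForm i (Finsupp.single j 1) = 0 := by rw [geomForm_single, h, hc, mul_zero]
      have e2 : M.geomForm j (Finsupp.single i 1) = 0 := by rw [geomForm_single, h', hc, mul_zero]
      simp only [LinearEquiv.mul_apply, geomReflection_apply, map_sub, map_smul,
        geomForm_single_self, e1, e2, LinearEquiv.coe_one, id]
      module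
  · apply LinearEquiv.toLinearMap_injective
    have hs := sin_two_mul_pi_div_ne_zero hm
    have hm0 : (M i j : ℝ) ≠ 0 := by
      have : M i j ≠ 0 := by omega
      exact_mod_cast this
    rw [geomReflection, geomReflection, Module.reflection_mul_reflection_pow _ _ _
      (2 * cos (2 * (π / M i j))) (M.geomForm_mul_geomForm i j).symm]
    obtain ⟨k, hk | hk⟩ := Nat.even_or_odd' (M i j)
    · have e1 : ((M i j : ℤ) - 2) / 2 = k - 1 := by omega
      have e2 : ((M i j : ℤ) - 1) / 2 = k - 1 := by omega
      have hz : (S ℝ ((k : ℤ) - 1)).eval (2 * cos (2 * (π / M i j))) = 0 := by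
        rw [eval_S_two_mul_cos _ hs]
        have : (((k - 1 : ℤ) : ℝ) + 1) * (2 * (π / M i j)) = π := by
          have : (M i j : ℝ) = 2 * k := by exact_mod_cast hk
          push_cast
          field_simp
          rw [this]; ring
        rw [this, sin_pi, zero_div]
      rw [e1, e2, hz]
      simp
    · have e1 : ((M i j : ℤ) - 2) / 2 = k - 1 := by omega
      have e2 : ((M i j : ℤ) - 1) / 2 = k := by omega
      have e3 : ((M i j : ℤ) - 3) / 2 = k - 1 := by omega
      have e4 : (M i j : ℤ) / 2 = k := by omega
      have hz : (S ℝ (k : ℤ)).eval (2 * cos (2 * (π / M i j))) +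
          (S ℝ ((k : ℤ) - 1)).eval (2 * cos (2 * (π / M i j))) = 0 := by
        rw [eval_S_two_mul_cos _ hs, eval_S_two_mul_cos _ hs, ← add_div]
        have hk' : (M i j : ℝ) = 2 * k + 1 := by exact_mod_cast hk
        have a1 : (((k : ℤ) : ℝ) + 1) * (2 * (π / M i j)) = π / M i j + π := by
          push_cast
          field_simp
          rw [hk']; ring
        have a2 : (((k - 1 : ℤ) : ℝ) + 1) * (2 * (π / M i j)) = π - π / M i j := by
          push_cast
          field_simp
          rw [hk']; ring
        rw [a1, a2, sin_add_pi, sin_pi_sub]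
        simp
      rw [e1, e2, e3, e4, hz]
      simp

theorem dvd_of_geomReflection_pow_eq_one {i j : B} {k : ℕ}
    (h : (M.geomReflection i * M.geomReflection j) ^ k = 1) : M i j ∣ k := by
  by_cases hij : i = j
  · simp [hij]
  have h1 := M.off_diagonal i j hij
  -- The image of one basis vector suffices: its coordinates at `i` and `j` give two trigonometric
  -- equations for `k`.
  have key : ((M.geomReflection i * M.geomReflection j) ^ k) (Finsupp.single i 1)
    = Finsupp.single i 1 := by rw [h]; rfl
  rw [geomReflection, geomReflection, Module.reflection_mul_reflection_pow_apply_self _ _ _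
      (2 * cos (2 * (π / M i j))) (M.geomForm_mul_geomForm i j).symm,
      show M.geomForm j (Finsupp.single i 1) = -2 * cos (π / M i j) by
        rw [geomForm_single, M.symmetric j i]] at key
  have ki := DFunLike.congr_fun key i
  have kj := DFunLike.congr_fun key j
  simp [hij, Ne.symm hij] at ki kj
  rcases Nat.lt_or_ge (M i j) 3 with hm | hm
  · obtain h | h : M i j = 0 ∨ M i j = 2 := by omega
    · simp [h, S_eval_two] at kj
      simp [kj]
    -- Here the `j`-coordinate carries no information; the `i`-coordinate is `(-1)^k`, which forces
    -- `k` to be even.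
    · have : (2 : ℝ) * cos (2 * (π / M i j)) = -2 := by
        rw [h]
        have : 2 * (π / (2 : ℕ)) = π := by push_cast; ring
        rw [this, cos_pi]; norm_num
      rw [this, S_eval_neg_two, S_eval_neg_two, Int.negOnePow_sub, Int.negOnePow_one] at ki
      rw [h]
      by_contra hk
      have hodd : Odd (k : ℤ) := by
        rw [Int.odd_iff]; omega
      rw [Int.negOnePow_odd _ hodd] at ki
      push_cast at ki
      simp at ki
      linarith
  · have hs := sin_two_mul_pi_div_ne_zero hm
    have h3 : (3 : ℝ) ≤ M i j := by exact_mod_cast hm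
    have hc : cos (π / M i j) ≠ 0 := by
      refine (cos_pos_of_mem_Ioo ⟨?_, ?_⟩).ne'
      · have : 0 < π / M i j := by positivity
        linarith [pi_pos]
      · rw [div_lt_div_iff_of_pos_left pi_pos (by positivity) two_pos]
        linarith
    have kj' := kj.resolve_right hc
    rw [kj', add_zero, eval_S_two_mul_cos _ hs, div_eq_one_iff_eq hs] at ki
    rw [eval_S_two_mul_cos _ hs, div_eq_zero_iff, or_iff_left hs] at kj'
    push_cast at ki kj'
    rw [sub_add_cancel] at kj'
    rw [add_mul, one_mul, sin_add, kj', zero_mul, zero_add, mul_eq_right₀ hs, cos_eq_one_iff] at ki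
    obtain ⟨n, hn⟩ := ki
    have : (k : ℝ) = M i j * n := by
      field_simp at hn
      linarith
    exact Int.natCast_dvd_natCast.1 ⟨n, by exact_mod_cast this⟩

end CoxeterMatrix

namespace CoxeterSystem

variable {B W : Type*} [Group W] {M : CoxeterMatrix B} (cs : CoxeterSystem M W)

/-- The geometric representation. -/
noncomputable def geomRep : W →* ((B →₀ ℝ) ≃ₗ[ℝ] (B →₀ ℝ)) :=
  cs.lift ⟨M.geomReflection, M.geomReflection_liftable⟩

theorem geomRep_simple (i : B) : cs.geomRep (cs.simple i) = M.geomReflection i :=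
  cs.lift_apply_simple _ i

/-- The entries of the Coxeter matrix are the orders of the products of two generators. -/
theorem orderOf_simple_mul_simple (i j : B) : orderOf (cs.simple i * cs.simple j) = M i j := by
  refine Nat.dvd_antisymm (orderOf_dvd_of_pow_eq_one (cs.simple_mul_simple_pow i j)) ?_
  apply M.dvd_of_geomReflection_pow_eq_one
  rw [← cs.geomRep_simple, ← cs.geomRep_simple, ← map_mul, ← map_pow, pow_orderOf_eq_one, map_one]

theorem simple_mem_specialSubgroup {T : Set B} {i : B} (hi : i ∈ T) :
    cs.simple i ∈ cs.specialSubgroup T :=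
  Subgroup.subset_closure (Set.mem_image_of_mem _ hi)

/-- A reflection changes only its own coordinate. So `W_T` preserves the coordinate at any `i ∉ T`,
while `s i` negates the `i`-th basis vector. -/
theorem simple_mem_specialSubgroup_iff {T : Set B} {i : B} :
    cs.simple i ∈ cs.specialSubgroup T ↔ i ∈ T := by
  refine ⟨fun h => ?_, cs.simple_mem_specialSubgroup⟩
  by_contra hi
  have key : ∀ w ∈ cs.specialSubgroup T, ∀ v : B →₀ ℝ, cs.geomRep w v i = v i := by
    intro w hw
    induction hw using Subgroup.closure_induction with
    | mem x hx =>
      obtain ⟨t, ht, rfl⟩ := hx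
      intro v
      have : t ≠ i := fun h => hi (h ▸ ht)
      simp [geomRep_simple, CoxeterMatrix.geomReflection_apply, this]
    | one => simp
    | mul x y _ _ hx hy => intro v; rw [map_mul, LinearEquiv.mul_apply, hx, hy]
    | inv x _ hx =>
      intro v
      rw [← hx (cs.geomRep x⁻¹ v), ← LinearEquiv.mul_apply, ← map_mul, mul_inv_cancel, map_one]
      rfl
  have := key _ h (Finsupp.single i 1)
  rw [geomRep_simple, CoxeterMatrix.geomReflection_apply, M.geomForm_single_self] at this
  simp at this

theorem simple_injective : Function.Injective cs.simple := by
  intro i j h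
  have : cs.simple i ∈ cs.specialSubgroup {j} := by
    rw [h]; exact cs.simple_mem_specialSubgroup (Set.mem_singleton j)
  simpa using cs.simple_mem_specialSubgroup_iff.1 this

end CoxeterSystem

/-! ### Signed conjugation and the exchange property -/

theorem Function.End.mul_apply {α : Type*} (f g : Function.End α) (x : α) :
    (f * g) x = f (g x) := rfl

namespace CoxeterSystem

variable {B W : Type*} [Group W] {M : CoxeterMatrix B} (cs : CoxeterSystem M W)

open Classical in
/-- The action of a generator on elements of `W` with a sign: conjugation, with a change of sign at
the generator itself. -/
noncomputable def signedConj (i : B) : Function.End (W × ZMod 2) := fun p =>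
  (cs.simple i * p.1 * cs.simple i, p.2 + if p.1 = cs.simple i then 1 else 0)

open Classical in
theorem signedConj_mul_pow_apply (i j : B) (k : ℕ) (p : W × ZMod 2) :
    ((cs.signedConj i * cs.signedConj j) ^ k) p =
      ((cs.simple i * cs.simple j) ^ k * p.1 * ((cs.simple i * cs.simple j) ^ k)⁻¹,
        p.2 + ∑ n ∈ Finset.range (2 * k),
          if p.1 = (cs.simple j * cs.simple i) ^ n * cs.simple j then 1 else 0) := by
  have hz : cs.simple j * cs.simple i = (cs.simple i * cs.simple j)⁻¹ := by simp
  have hs (n : ℕ) : cs.simple j * (cs.simple i * cs.simple j) ^ n =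
      (cs.simple j * cs.simple i) ^ n * cs.simple j := by
    induction n with
    | zero => simp
    | succ n ih => rw [pow_succ, ← mul_assoc, ih, pow_succ]; simp only [mul_assoc]
  induction k with
  | zero => simp [Function.End.one_def]
  | succ k ih =>
    rw [pow_succ', Function.End.mul_apply, ih, Function.End.mul_apply]
    simp only [signedConj, Prod.mk.injEq]
    refine ⟨?_, ?_⟩
    · rw [pow_succ', mul_inv_rev, mul_inv_rev]
      simp only [mul_assoc, inv_simple]
    · rw [mul_add, mul_one, Finset.sum_range_succ, Finset.sum_range_succ, add_assoc, add_assoc,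
        add_assoc]
      congr 3
      -- The new indices `2 * k` and `2 * k + 1` record the sign changes made by `s j` and then by
      -- `s i`.
      · congr 1
        rw [mul_inv_eq_iff_eq_mul, hs, eq_iff_iff, hz, two_mul, pow_add, inv_pow, mul_assoc,
          eq_inv_mul_iff_mul_eq, eq_inv_mul_iff_mul_eq, eq_inv_mul_iff_mul_eq]
      · congr 1
        set z := (cs.simple i * cs.simple j) ^ k with hzk
        rw [eq_iff_iff]
        have e : (cs.simple j * cs.simple i) ^ (2 * k + 1) * cs.simple j =
            z⁻¹ * (cs.simple j * cs.simple i * cs.simple j) * z := by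
          rw [mul_assoc z⁻¹, mul_assoc _ _ z, hs, ← inv_pow, ← hz]
          rw [show 2 * k + 1 = k + 1 + k by ring, pow_add, pow_add]
          simp only [mul_assoc, pow_one]
        rw [e]
        constructor
        · intro h
          rw [← h]
          simp [mul_assoc]
        · intro h
          rw [h]
          simp [mul_assoc]

/-- For exponent `m` the sequence of `2m` elements where the sign changes has period `m`, so every
element is hit an even number of times. -/
theorem signedConj_liftable : M.IsLiftable cs.signedConj := by
  classical
  intro i j
  funext p
  rw [signedConj_mul_pow_apply, Function.End.one_def, cs.simple_mul_simple_pow, two_mul,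
    Finset.sum_range_add]
  have (n : ℕ) : (cs.simple j * cs.simple i) ^ (M i j + n) = (cs.simple j * cs.simple i) ^ n := by
    rw [pow_add, cs.simple_mul_simple_pow', one_mul]
  simp only [this, CharTwo.add_self_eq_zero]
  simp

/-- The action of `W` on signed elements of `W`. -/
noncomputable def signedConjHom : W →* Function.End (W × ZMod 2) :=
  cs.lift ⟨cs.signedConj, cs.signedConj_liftable⟩

open Classical in
-- The left side depends only on the product of the word. Hence so does the parity of the number of
-- occurrences of an element in the right inversion sequence.
theorem signedConjHom_wordProd (ω : List B) (p : W × ZMod 2) :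
    cs.signedConjHom (cs.wordProd ω) p =
      (cs.wordProd ω * p.1 * (cs.wordProd ω)⁻¹, p.2 + (cs.rightInvSeq ω).count p.1) := by
  induction ω with
  | nil => simp [Function.End.one_def]
  | cons i ω ih =>
    rw [wordProd_cons, map_mul, Function.End.mul_apply, ih, signedConjHom,
      lift_apply_simple]
    simp only [signedConj, rightInvSeq, List.count_cons, Prod.mk.injEq, beq_iff_eq]
    refine ⟨by simp [mul_assoc], ?_⟩
    push_cast
    rw [add_assoc]
    congr 3
    rw [mul_inv_eq_iff_eq_mul, mul_assoc, inv_mul_eq_iff_eq_mul]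
    exact propext eq_comm

/-- A right descent of `w` occurs in the right inversion sequence of every word for `w`. -/
theorem simple_mem_rightInvSeq {ω : List B} {i : B} (h : cs.IsRightDescent (cs.wordProd ω) i) :
    cs.simple i ∈ cs.rightInvSeq ω := by
  classical
  -- A reduced word for the same element ending in `i` has `s i` exactly once in its inversion
  -- sequence, so in any other word the count is odd.
  obtain ⟨ω', hω', e⟩ := cs.exists_isReduced (cs.wordProd ω * cs.simple i)
  have e' : cs.wordProd ω = cs.wordProd (ω'.concat i) := by
    rw [wordProd_concat, ← e, simple_mul_simple_cancel_right]
  have hred : cs.IsReduced (ω'.concat i) := by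
    rw [IsReduced, ← e', List.length_concat, ← hω'.eq, ← e]
    exact (cs.isRightDescent_iff.1 h).symm
  have hmem : cs.simple i ∈ cs.rightInvSeq (ω'.concat i) := by
    rw [rightInvSeq_concat, List.concat_eq_append]; simp
  have h1 := cs.signedConjHom_wordProd ω (cs.simple i, 0)
  rw [e', signedConjHom_wordProd, List.count_eq_one_of_mem hred.nodup_rightInvSeq hmem,
    Prod.mk.injEq] at h1
  by_contra hn
  rw [List.count_eq_zero_of_not_mem hn] at h1
  simp at h1

/-- The exchange property, for right descents of a product. -/
theorem exists_exchange_right {u v : W} {i : B} (h : cs.IsRightDescent (u * v) i) :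
    cs.IsRightDescent v i ∨ ∃ u', u * v * cs.simple i = u' * v ∧ cs.length u' < cs.length u := by
  obtain ⟨ω, hω, rfl⟩ := cs.exists_isReduced u
  obtain ⟨η, hη, rfl⟩ := cs.exists_isReduced v
  rw [← wordProd_append] at h
  obtain ⟨j, hj, e⟩ := List.getElem_of_mem (cs.simple_mem_rightInvSeq h)
  have key := cs.wordProd_mul_getD_rightInvSeq (ω ++ η) j
  rw [List.getD_eq_getElem _ _ hj, e, wordProd_append] at key
  rw [length_rightInvSeq, List.length_append] at hj
  -- Multiplying by `s i` deletes the `j`-th letter, which belongs to the word of `u` or to that of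
  -- `v`.
  rcases lt_or_ge j ω.length with hlt | hge
  · right
    rw [List.eraseIdx_append_of_lt_length hlt, wordProd_append] at key
    refine ⟨_, key, (cs.length_wordProd_le _).trans_lt ?_⟩
    rw [hω.eq, List.length_eraseIdx_of_lt hlt]
    omega
  · left
    rw [List.eraseIdx_append_of_length_le hge, wordProd_append, mul_assoc, mul_right_inj] at key
    rw [IsRightDescent, key]
    refine (cs.length_wordProd_le _).trans_lt ?_
    rw [hη.eq, List.length_eraseIdx_of_lt (by omega)]
    omega

/-- The exchange property, for left descents of a product. -/
theorem exists_exchange_left {u v : W} {i : B} (h : cs.IsLeftDescent (u * v) i) :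
    cs.IsLeftDescent u i ∨ ∃ v', cs.simple i * (u * v) = u * v' ∧ cs.length v' < cs.length v := by
  rw [← isRightDescent_inv_iff, mul_inv_rev] at h
  rcases cs.exists_exchange_right h with h | ⟨v', e, hl⟩
  · exact Or.inl (cs.isRightDescent_inv_iff.1 h)
  · refine Or.inr ⟨v'⁻¹, ?_, by rwa [length_inv, ← cs.length_inv v]⟩
    rw [← inv_inj]
    simpa [mul_assoc] using e

/-- If a left descent appears after right multiplication by a generator, both multiplications have
the same effect. -/
theorem simple_mul_eq_mul_simple {w : W} {i j : B} (h : ¬ cs.IsLeftDescent w i)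
    (h' : cs.IsLeftDescent (w * cs.simple j) i) : cs.simple i * w = w * cs.simple j := by
  obtain ⟨v, e, hv⟩ := (cs.exists_exchange_left h').resolve_left h
  rw [length_simple, Nat.lt_one_iff, length_eq_zero_iff] at hv
  rw [hv, mul_one, ← mul_assoc] at e
  nth_rw 2 [← e]
  rw [simple_mul_simple_cancel_right]

end CoxeterSystem

/-! ### Descents and special subgroups -/

namespace CoxeterSystem

variable {B W : Type*} [Group W] {M : CoxeterMatrix B} (cs : CoxeterSystem M W)

theorem isLeftDescent_simple_mul {w : W} {i : B} (h : ¬ cs.IsLeftDescent w i) :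
    cs.IsLeftDescent (cs.simple i * w) i := by
  rw [isLeftDescent_iff_not_isLeftDescent_mul, simple_mul_simple_cancel_left]
  exact h

theorem not_isLeftDescent_simple_mul {w : W} {i : B} (h : cs.IsLeftDescent w i) :
    ¬ cs.IsLeftDescent (cs.simple i * w) i :=
  cs.isLeftDescent_iff_not_isLeftDescent_mul.1 h

/-- The left descents of an element of a special subgroup. -/
theorem mem_of_isLeftDescent {T : Set B} {w : W} (hw : w ∈ cs.specialSubgroup T) {i : B}
    (hi : cs.IsLeftDescent w i) : i ∈ T := by
  induction hw using Subgroup.closure_induction_right with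
  | one => exact absurd hi (cs.not_isLeftDescent_one i)
  | mul_right x hx y hy ih =>
    obtain ⟨t, ht, rfl⟩ := hy
    by_cases h : cs.IsLeftDescent x i
    · exact ih h
    -- A descent that first appears here satisfies `s i * x = x * s t`, so `s i` itself lies in
    -- `W_T`.
    · have e := cs.simple_mul_eq_mul_simple h hi
      rw [← cs.simple_mem_specialSubgroup_iff, ← Subgroup.mul_mem_cancel_right (cs.specialSubgroup T) hx, e]
      exact mul_mem hx (cs.simple_mem_specialSubgroup ht)
  | mul_inv_cancel x hx y hy ih =>
    obtain ⟨t, ht, rfl⟩ := hy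
    rw [inv_simple] at hi
    by_cases h : cs.IsLeftDescent x i
    · exact ih h
    · have e := cs.simple_mul_eq_mul_simple h hi
      rw [← cs.simple_mem_specialSubgroup_iff, ← Subgroup.mul_mem_cancel_right (cs.specialSubgroup T) hx, e]
      exact mul_mem hx (cs.simple_mem_specialSubgroup ht)

theorem exists_leftDescent_mem {T : Set B} {w : W} (hw : w ∈ cs.specialSubgroup T) (h1 : w ≠ 1) :
    ∃ t ∈ T, cs.IsLeftDescent w t := by
  obtain ⟨t, ht⟩ := cs.exists_leftDescent_of_ne_one h1
  exact ⟨t, cs.mem_of_isLeftDescent hw ht, ht⟩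

/-- Induction over a special subgroup, adding letters on the left with increasing length. -/
theorem specialSubgroup_induction {T : Set B} {p : (u : W) → u ∈ cs.specialSubgroup T → Prop}
    (one : p 1 (one_mem _))
    (mul : ∀ u hu t, ∀ ht : t ∈ T, ¬ cs.IsLeftDescent u t → p u hu →
      p (cs.simple t * u) (mul_mem (cs.simple_mem_specialSubgroup ht) hu))
    {u : W} (hu : u ∈ cs.specialSubgroup T) : p u hu := by
  induction hn : cs.length u using Nat.strong_induction_on generalizing u with
  | _ n ih =>
    by_cases h1 : u = 1
    · subst h1; exact one
    obtain ⟨t, ht, hd⟩ := cs.exists_leftDescent_mem hu h1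
    have hm := mul_mem (cs.simple_mem_specialSubgroup ht) hu
    have hlt : cs.length (cs.simple t * u) < n := hn ▸ (show _ < _ from hd)
    have := mul _ hm t ht (cs.not_isLeftDescent_simple_mul hd) (ih _ hlt hm rfl)
    simpa only [simple_mul_simple_cancel_left] using this

/-- If all elements of `T` are left descents of `w`, then all elements of `W_T` are initial segments
of `w`. -/
theorem length_add_length_inv_mul {T : Set B} {w : W} (hw : ∀ t ∈ T, cs.IsLeftDescent w t) {u : W}
    (hu : u ∈ cs.specialSubgroup T) : cs.length u + cs.length (u⁻¹ * w) = cs.length w := by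
  induction hu using cs.specialSubgroup_induction with
  | one => simp
  | mul u hu t ht hd ih =>
    have hw' := hw t ht
    rw [← mul_inv_cancel_left u w] at hw'
    obtain ⟨v, e, hv⟩ := (cs.exists_exchange_left hw').resolve_left hd
    rw [mul_inv_cancel_left] at e
    have h1 : (cs.simple t * u)⁻¹ * w = v := by
      rw [mul_inv_rev, inv_simple, mul_assoc, e, inv_mul_cancel_left]
    have h2 : w = cs.simple t * u * v := by rw [← h1, mul_inv_cancel_left]
    have h3 := cs.length_mul_le (cs.simple t * u) v
    rw [← h2] at h3
    have h4 := cs.not_isLeftDescent_iff.1 hd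
    rw [h1]
    omega

/-- Initial segments of elements of `W_T` are elements of `W_T`. -/
theorem mem_specialSubgroup_of_length_add {T : Set B} {u w : W} (hw : w ∈ cs.specialSubgroup T)
    (h : cs.length u + cs.length (u⁻¹ * w) = cs.length w) : u ∈ cs.specialSubgroup T := by
  induction hn : cs.length u using Nat.strong_induction_on generalizing u w with
  | _ n ih =>
    by_cases h1 : u = 1
    · rw [h1]; exact one_mem _
    obtain ⟨t, hd⟩ := cs.exists_leftDescent_of_ne_one h1
    have h2 := cs.isLeftDescent_iff.1 hd
    have h3 := cs.length_mul_le (cs.simple t * u) (u⁻¹ * w)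
    rw [mul_assoc, mul_inv_cancel_left] at h3
    have h4 := cs.length_simple_mul w t
    have hdw : cs.IsLeftDescent w t := by
      rw [IsLeftDescent]; omega
    have ht := cs.simple_mem_specialSubgroup (cs.mem_of_isLeftDescent hw hdw)
    have h5 : (cs.simple t * u)⁻¹ * (cs.simple t * w) = u⁻¹ * w := by group
    have := ih (cs.length (cs.simple t * u)) (by omega) (mul_mem ht hw) (by rw [h5]; omega) rfl
    exact (Subgroup.mul_mem_cancel_left _ ht).1 this

theorem finite_setOf_length_le [Finite B] (n : ℕ) : {w : W | cs.length w ≤ n}.Finite := by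
  refine ((List.finite_length_le B n).image cs.wordProd).subset ?_
  intro w hw
  obtain ⟨ω, hω, rfl⟩ := cs.exists_isReduced w
  exact ⟨ω, by rw [Set.mem_ofPred_eq, ← hω.eq]; exact hw, rfl⟩

/-- A longest element of the finite group `W_T` works. -/
theorem IsSpherical.exists_forall_isLeftDescent {cs : CoxeterSystem M W} {T : Set B}
    (hT : cs.IsSpherical T) :
    ∃ w ∈ cs.specialSubgroup T, ∀ t ∈ T, cs.IsLeftDescent w t := by
  obtain ⟨w, hw, hmax⟩ := Set.exists_max_image _ cs.length hT ⟨1, one_mem _⟩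
  refine ⟨w, hw, fun t ht => ?_⟩
  have := hmax _ (mul_mem (cs.simple_mem_specialSubgroup ht) hw)
  exact lt_of_le_of_ne this (cs.length_simple_mul_ne w t)

/-- If all of `T` are descents of `w`, the elements of `W_T` are initial segments of `w`, so their
lengths are bounded. This expresses sphericity in terms of the metric. -/
theorem isSpherical_iff [Finite B] {T : Set B} :
    cs.IsSpherical T ↔ ∃ w, ∀ t ∈ T, cs.IsLeftDescent w t := by
  refine ⟨fun h => ?_, fun ⟨w, hw⟩ => ?_⟩
  · obtain ⟨w, -, hw⟩ := h.exists_forall_isLeftDescent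
    exact ⟨w, hw⟩
  · refine (cs.finite_setOf_length_le (cs.length w)).subset fun u hu => ?_
    have := cs.length_add_length_inv_mul hw hu
    change cs.length u ≤ _
    omega

/-- Elements of a spherical special subgroup are the common initial segments of all elements that
have the whole of `T` as left descents. -/
theorem IsSpherical.mem_specialSubgroup_iff {cs : CoxeterSystem M W} {T : Set B}
    (hT : cs.IsSpherical T) {u : W} :
    u ∈ cs.specialSubgroup T ↔ ∀ w, (∀ t ∈ T, cs.IsLeftDescent w t) →
      cs.length u + cs.length (u⁻¹ * w) = cs.length w := by
  refine ⟨fun hu w hw => cs.length_add_length_inv_mul hw hu, fun h => ?_⟩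
  obtain ⟨w, hw, hd⟩ := hT.exists_forall_isLeftDescent
  exact cs.mem_specialSubgroup_of_length_add hw (h w hd)

/-- The dihedral group consists of the powers of `z = s i * s j` and their products with `s j`; `z`
has order `m i j`. -/
theorem isSpherical_pair {i j : B} (h : M i j ≠ 0) : cs.IsSpherical {i, j} := by
  set z := cs.simple i * cs.simple j with hz
  have hfin : (Subgroup.zpowers z : Set W).Finite := by
    rw [finite_zpowers, ← orderOf_pos_iff, cs.orderOf_simple_mul_simple]
    exact Nat.pos_of_ne_zero h
  have hi (n : ℤ) : z ^ n * cs.simple i = z ^ (n + 1) * cs.simple j := by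
    rw [zpow_add_one, hz]; simp [mul_assoc]
  have hi' (n : ℤ) : z ^ n * cs.simple j * cs.simple i = z ^ (n - 1) := by
    rw [zpow_sub_one, hz]; simp [mul_assoc]
  have key : ∀ x, (∃ n : ℤ, x = z ^ n ∨ x = z ^ n * cs.simple j) →
      ∀ y ∈ cs.simple '' {i, j}, ∃ n : ℤ, x * y = z ^ n ∨ x * y = z ^ n * cs.simple j := by
    rintro x ⟨n, rfl | rfl⟩ _ ⟨k, rfl | rfl, rfl⟩
    · exact ⟨n + 1, Or.inr (hi n)⟩
    · exact ⟨n, Or.inr rfl⟩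
    · exact ⟨n - 1, Or.inl (hi' n)⟩
    · exact ⟨n, Or.inl (by simp)⟩
  have hsub : ∀ x ∈ cs.specialSubgroup {i, j}, ∃ n : ℤ, x = z ^ n ∨ x = z ^ n * cs.simple j := by
    intro x hx
    induction hx using Subgroup.closure_induction_right with
    | one => exact ⟨0, Or.inl (by simp)⟩
    | mul_right x hx y hy ih => exact key x ih y hy
    | mul_inv_cancel x hx y hy ih =>
      have : y⁻¹ = y := by obtain ⟨k, -, rfl⟩ := hy; simp
      rw [this]
      exact key x ih y hy
  refine (hfin.union (hfin.image (· * cs.simple j))).subset fun x hx => ?_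
  obtain ⟨n, rfl | rfl⟩ := hsub x hx
  · exact Or.inl ⟨n, rfl⟩
  · exact Or.inr ⟨_, ⟨n, rfl⟩, rfl⟩

/-- If `m i j = ∞`, then `i` and `j` are never both left descents. -/
theorem not_isLeftDescent_of_eq_zero [Finite B] {i j : B} (h : M i j = 0) {w : W}
    (hi : cs.IsLeftDescent w i) : ¬ cs.IsLeftDescent w j := by
  intro hj
  have hs : cs.IsSpherical {i, j} := cs.isSpherical_iff.2 ⟨w, by
    rintro t (rfl | rfl)
    exacts [hi, hj]⟩
  have hz : cs.simple i * cs.simple j ∈ cs.specialSubgroup {i, j} :=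
    mul_mem (cs.simple_mem_specialSubgroup (by simp)) (cs.simple_mem_specialSubgroup (by simp))
  have hfin : (Subgroup.zpowers (cs.simple i * cs.simple j) : Set W).Finite :=
    Set.Finite.subset hs (SetLike.coe_subset_coe.2 (Subgroup.zpowers_le.2 hz))
  rw [finite_zpowers, ← orderOf_pos_iff, cs.orderOf_simple_mul_simple, h] at hfin
  exact hfin.false

/-- An element without left descents in `T` is of minimal length in its coset of `W_T`. -/
theorem length_mul_of_forall_not_isLeftDescent {T : Set B} {y : W}
    (hy : ∀ t ∈ T, ¬ cs.IsLeftDescent y t) {u : W} (hu : u ∈ cs.specialSubgroup T) :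
    cs.length (u * y) = cs.length u + cs.length y := by
  -- Additivity is first proved for a shortest element `y₀` of the coset `W_T y`; then `y = y₀`,
  -- since a left descent of `y * y₀⁻¹` in `T` would be one of `y`.
  have hmin : ∃ y₀, y * y₀⁻¹ ∈ cs.specialSubgroup T ∧
      ∀ v ∈ cs.specialSubgroup T, cs.length y₀ ≤ cs.length (v * y₀) := by
    obtain ⟨y₀, hy₀, hl⟩ := (InvImage.wf cs.length Nat.lt_wfRel.wf).has_min
      {x : W | y * x⁻¹ ∈ cs.specialSubgroup T} ⟨y, by simp [one_mem]⟩
    refine ⟨y₀, hy₀, fun v hv => ?_⟩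
    refine not_lt.1 (hl (v * y₀) ?_)
    change y * (v * y₀)⁻¹ ∈ cs.specialSubgroup T
    rw [mul_inv_rev, ← mul_assoc]
    exact mul_mem hy₀ (inv_mem hv)
  obtain ⟨y₀, hy₀, hmin⟩ := hmin
  have key : ∀ v ∈ cs.specialSubgroup T, cs.length (v * y₀) = cs.length v + cs.length y₀ := by
    intro v hv
    induction hv using cs.specialSubgroup_induction with
    | one => simp
    | mul v hv t ht hd ih =>
      rw [mul_assoc, cs.not_isLeftDescent_iff.1 hd, add_right_comm, ← ih, ← not_isLeftDescent_iff]
      intro hd'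
      obtain ⟨x, e, hx⟩ := (cs.exists_exchange_left hd').resolve_left hd
      have hm : v⁻¹ * (cs.simple t * v) ∈ cs.specialSubgroup T :=
        mul_mem (inv_mem hv) (mul_mem (cs.simple_mem_specialSubgroup ht) hv)
      have := hmin _ hm
      rw [mul_assoc, mul_assoc, e, inv_mul_cancel_left] at this
      omega
  have h1 : y * y₀⁻¹ = 1 := by
    by_contra hne
    obtain ⟨t, ht, hd⟩ := cs.exists_leftDescent_mem hy₀ hne
    refine hy t ht ?_
    have e1 := key _ hy₀
    have e2 := key _ (mul_mem (cs.simple_mem_specialSubgroup ht) hy₀)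
    rw [inv_mul_cancel_right] at e1
    rw [mul_assoc, inv_mul_cancel_right] at e2
    rw [IsLeftDescent] at hd ⊢
    omega
  rw [mul_inv_eq_one.1 h1]
  exact key u hu

end CoxeterSystem

namespace CoxeterSystem

variable {B W : Type*} [Group W] {M : CoxeterMatrix B} {cs : CoxeterSystem M W}

/-! ### Automorphisms of the Cayley graph and special cosets -/

theorem cayleyAut_mul_simple (g : cs.CayleyAut) (v : W) (i : B) :
    ∃ j, g (v * cs.simple i) = g v * cs.simple j :=
  g.map_rel_iff.2 ⟨i, rfl⟩

theorem length_inv_mul_map_le (g : cs.CayleyAut) (x z : W) :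
    cs.length ((g x)⁻¹ * g (x * z)) ≤ cs.length z := by
  induction hn : cs.length z using Nat.strong_induction_on generalizing z with
  | _ n ih =>
    by_cases h1 : z = 1
    · simp [h1]
    obtain ⟨i, hi⟩ := cs.exists_rightDescent_of_ne_one h1
    have h2 := cs.isRightDescent_iff.1 hi
    obtain ⟨j, hj⟩ := cayleyAut_mul_simple g (x * (z * cs.simple i)) i
    rw [mul_assoc, simple_mul_simple_cancel_right] at hj
    have h3 := ih (cs.length (z * cs.simple i)) (by omega) _ rfl
    have h4 := cs.length_mul_le ((g x)⁻¹ * g (x * (z * cs.simple i))) (cs.simple j)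
    rw [length_simple] at h4
    rw [hj, ← mul_assoc]
    omega

/-- Automorphisms of the Cayley graph preserve the word metric. -/
theorem length_inv_mul_map (g : cs.CayleyAut) (x y : W) :
    cs.length ((g x)⁻¹ * g y) = cs.length (x⁻¹ * y) := by
  apply le_antisymm
  · simpa using length_inv_mul_map_le g x (x⁻¹ * y)
  · simpa using length_inv_mul_map_le g.symm (g x) ((g x)⁻¹ * g y)

/-- The map on generators induced by an automorphism of the Cayley graph at a vertex. -/
noncomputable def localType (g : cs.CayleyAut) (v : W) (i : B) : B :=
  (cayleyAut_mul_simple g v i).choose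

theorem map_mul_simple (g : cs.CayleyAut) (v : W) (i : B) :
    g (v * cs.simple i) = g v * cs.simple (localType g v i) :=
  (cayleyAut_mul_simple g v i).choose_spec

theorem localType_symm_localType (g : cs.CayleyAut) (v : W) (i : B) :
    localType g.symm (g v) (localType g v i) = i := by
  apply cs.simple_injective
  have := map_mul_simple g.symm (g v) (localType g v i)
  rw [← map_mul_simple, RelIso.symm_apply_apply, RelIso.symm_apply_apply] at this
  exact (mul_left_cancel this).symm

theorem localType_localType_symm (g : cs.CayleyAut) (v : W) (i : B) :
    localType g v (localType g.symm (g v) i) = i := by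
  apply cs.simple_injective
  have := map_mul_simple g v (localType g.symm (g v) i)
  have h2 := map_mul_simple g.symm (g v) i
  rw [RelIso.symm_apply_apply] at h2
  rw [← h2, RelIso.apply_symm_apply] at this
  exact (mul_left_cancel this).symm

/-- The permutation of the generators induced by an automorphism of the Cayley graph at a vertex. -/
noncomputable def localPerm (g : cs.CayleyAut) (v : W) : Equiv.Perm B where
  toFun := localType g v
  invFun := localType g.symm (g v)
  left_inv := localType_symm_localType g v
  right_inv := localType_localType_symm g v

theorem map_mul_simple_localPerm (g : cs.CayleyAut) (v : W) (i : B) :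
    g (v * cs.simple i) = g v * cs.simple (localPerm g v i) :=
  map_mul_simple g v i

theorem localPerm_eq {g : cs.CayleyAut} {v : W} {i j : B}
    (h : g (v * cs.simple i) = g v * cs.simple j) : localPerm g v i = j := by
  rw [map_mul_simple_localPerm] at h
  exact cs.simple_injective (mul_left_cancel h)

theorem localPerm_symm (g : cs.CayleyAut) (v : W) :
    localPerm g.symm (g v) = (localPerm g v).symm := by
  ext i
  rfl

/-- Both sides compare the distances to the endpoint from a vertex and from its neighbour across one
edge. -/
theorem isLeftDescent_map (g : cs.CayleyAut) (v w : W) (i : B) :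
    cs.IsLeftDescent ((g v)⁻¹ * g w) (localPerm g v i) ↔ cs.IsLeftDescent (v⁻¹ * w) i := by
  have h1 : cs.simple i * (v⁻¹ * w) = (v * cs.simple i)⁻¹ * w := by simp [mul_assoc]
  have h2 : cs.simple (localPerm g v i) * ((g v)⁻¹ * g w) = (g (v * cs.simple i))⁻¹ * g w := by
    rw [map_mul_simple_localPerm]; simp [mul_assoc]
  rw [IsLeftDescent, IsLeftDescent, h1, h2, length_inv_mul_map, length_inv_mul_map]

theorem forall_isLeftDescent_map (g : cs.CayleyAut) (v w : W) (T : Set B) :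
    (∀ t ∈ localPerm g v '' T, cs.IsLeftDescent ((g v)⁻¹ * g w) t) ↔
      ∀ t ∈ T, cs.IsLeftDescent (v⁻¹ * w) t := by
  simp only [Set.forall_mem_image, isLeftDescent_map]

theorem IsSpherical.image_localPerm [Finite B] {T : Set B} (hT : cs.IsSpherical T)
    (g : cs.CayleyAut) (v : W) : cs.IsSpherical (localPerm g v '' T) := by
  obtain ⟨w, hw⟩ := cs.isSpherical_iff.1 hT
  rw [← inv_mul_cancel_left v w, ← forall_isLeftDescent_map g] at hw
  exact cs.isSpherical_iff.2 ⟨_, hw⟩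

/-- Automorphisms of the Cayley graph map spherical cosets to spherical cosets. -/
theorem IsSpherical.image_smul [Finite B] {T : Set B} (hT : cs.IsSpherical T) (g : cs.CayleyAut)
    (v : W) : g '' (v • (cs.specialSubgroup T : Set W)) =
      g v • (cs.specialSubgroup (localPerm g v '' T) : Set W) := by
  ext y
  obtain ⟨x, rfl⟩ := g.surjective y
  -- Membership of `x` in the coset becomes metric: `x` lies on a geodesic from `v` to every `w` for
  -- which all of `T` are left descents of `v⁻¹ * w`.
  rw [g.injective.mem_set_image, Set.mem_smul_set_iff_inv_smul_mem,
    Set.mem_smul_set_iff_inv_smul_mem, SetLike.mem_coe, SetLike.mem_coe, smul_eq_mul, smul_eq_mul,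
    hT.mem_specialSubgroup_iff, (hT.image_localPerm g v).mem_specialSubgroup_iff]
  have e (v x w : W) : (v⁻¹ * x)⁻¹ * (v⁻¹ * w) = x⁻¹ * w := by group
  constructor
  · intro h w hw
    obtain ⟨w, rfl⟩ := (MulAction.surjective (g v)⁻¹) w
    obtain ⟨w, rfl⟩ := g.surjective w
    simp only [smul_eq_mul] at hw ⊢
    rw [forall_isLeftDescent_map] at hw
    have := h _ hw
    rw [e] at this
    rwa [e, length_inv_mul_map, length_inv_mul_map, length_inv_mul_map]
  · intro h w hw
    rw [← inv_mul_cancel_left v w, ← forall_isLeftDescent_map g] at hw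
    have := h _ hw
    rw [e, length_inv_mul_map, length_inv_mul_map, length_inv_mul_map, inv_mul_cancel_left] at this
    rwa [mul_inv_rev, inv_inv, mul_assoc]

theorem smul_specialSubgroup_eq {T : Set B} {v w : W}
    (h : v ∈ w • (cs.specialSubgroup T : Set W)) :
    w • (cs.specialSubgroup T : Set W) = v • (cs.specialSubgroup T : Set W) := by
  rw [Set.mem_smul_set_iff_inv_smul_mem, smul_eq_mul] at h
  exact (leftCoset_eq_iff _).2 h

/-! ### The isomorphism between the automorphism groups -/

theorem image_mem_sphericalCoset [Finite B] (g : cs.CayleyAut) (C : cs.SphericalCoset) :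
    ∃ (w : W) (T : Set B), cs.IsSpherical T ∧
      g '' (C : Set W) = w • (cs.specialSubgroup T : Set W) := by
  obtain ⟨C, w, T, hT, rfl⟩ := C
  exact ⟨g w, _, hT.image_localPerm g w, hT.image_smul g w⟩

/-- The permutation of the spherical cosets induced by an automorphism of the Cayley graph. -/
def cosetPerm [Finite B] (g : cs.CayleyAut) : Equiv.Perm cs.SphericalCoset where
  toFun C := ⟨g '' (C : Set W), image_mem_sphericalCoset g C⟩
  invFun C := ⟨g.symm '' (C : Set W), image_mem_sphericalCoset g.symm C⟩
  left_inv C := by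
    ext1
    simp [Set.image_image]
  right_inv C := by
    ext1
    simp [Set.image_image]

theorem cosetPerm_le_iff [Finite B] (g : cs.CayleyAut) {C C' : cs.SphericalCoset} :
    cosetPerm g C ≤ cosetPerm g C' ↔ C ≤ C' :=
  Set.image_subset_image_iff g.injective

theorem image_cosetPerm_chamber [Finite B] (g : cs.CayleyAut) (w : W) :
    cosetPerm g '' cs.chamber w = cs.chamber (g w) := by
  ext C
  obtain ⟨C, rfl⟩ := (cosetPerm g).surjective C
  rw [(cosetPerm g).injective.mem_set_image]
  change w ∈ (C : Set W) ↔ g w ∈ g '' (C : Set W)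
  rw [g.injective.mem_set_image]

theorem cosetPerm_mem_davisAut [Finite B] (g : cs.CayleyAut) : cosetPerm g ∈ cs.davisAut := by
  refine ⟨fun σ => ?_, fun A => ⟨?_, ?_⟩⟩
  · change (σ.map (cosetPerm g).toEmbedding).Nonempty ∧
      IsChain (· ≤ ·) (σ.map (cosetPerm g).toEmbedding : Set cs.SphericalCoset) ↔
      σ.Nonempty ∧ IsChain (· ≤ ·) (σ : Set cs.SphericalCoset)
    rw [Finset.map_nonempty, Finset.coe_map]
    refine and_congr_right fun _ => ?_
    constructor
    · intro h x hx y hy hxy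
      exact (h ⟨x, hx, rfl⟩ ⟨y, hy, rfl⟩ ((cosetPerm g).injective.ne hxy)).imp
        (cosetPerm_le_iff g).1 (cosetPerm_le_iff g).1
    · rintro h _ ⟨x, hx, rfl⟩ _ ⟨y, hy, rfl⟩ hxy
      exact (h hx hy fun e => hxy (by rw [e])).imp
        (cosetPerm_le_iff g).2 (cosetPerm_le_iff g).2
  · rintro ⟨w, hw⟩
    refine ⟨g.symm w, ?_⟩
    apply (cosetPerm g).injective.image_injective
    rw [image_cosetPerm_chamber, RelIso.apply_symm_apply, hw]
  · rintro ⟨w, rfl⟩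
    exact ⟨g w, (image_cosetPerm_chamber g w).symm⟩

/-- The action of the automorphisms of the Cayley graph on the Davis complex. -/
def toDavisAut [Finite B] : cs.CayleyAut →* cs.DavisAut where
  toFun g := ⟨cosetPerm g, cosetPerm_mem_davisAut g⟩
  map_one' := by
    ext C : 2
    exact Subtype.ext (Set.image_id _)
  map_mul' g h := by
    ext C : 2
    exact Subtype.ext (Set.image_comp g h _)

theorem induces_toDavisAut [Finite B] (g : cs.CayleyAut) : Induces g (toDavisAut g) :=
  fun _ => rfl

/-! ### Recovering the Cayley graph from the Davis complex -/

theorem specialSubgroup_empty : (cs.specialSubgroup ∅ : Set W) = {1} := by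
  simp [specialSubgroup]

theorem specialSubgroup_singleton (i : B) :
    (cs.specialSubgroup {i} : Set W) = {1, cs.simple i} := by
  ext x
  simp only [SetLike.mem_coe, Set.mem_insert_iff, Set.mem_singleton_iff]
  constructor
  · intro hx
    rw [or_iff_not_imp_left]
    intro h1
    obtain ⟨j, rfl, hj⟩ := cs.exists_leftDescent_mem hx h1
    have hm := mul_mem (cs.simple_mem_specialSubgroup (Set.mem_singleton j)) hx
    have : cs.simple j * x = 1 := by
      by_contra h
      obtain ⟨k, rfl, hk⟩ := cs.exists_leftDescent_mem hm h
      exact cs.not_isLeftDescent_simple_mul hj hk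
    rw [← inv_simple, inv_mul_eq_one] at this
    exact this.symm
  · rintro (rfl | rfl)
    exacts [one_mem _, cs.simple_mem_specialSubgroup rfl]

variable (cs) in
/-- The vertex of the Davis complex given by an element of `W`. -/
def point (x : W) : cs.SphericalCoset :=
  ⟨{x}, x, ∅, by rw [IsSpherical, specialSubgroup_empty]; exact Set.finite_singleton 1, by
    rw [specialSubgroup_empty]; simp⟩

/-- This describes edges by spherical cosets, so that automorphisms of the Davis complex can be seen
to preserve them. -/
theorem cayleyGraph_adj_iff {a b : W} :
    cs.cayleyGraph.Adj a b ↔ a ≠ b ∧ ∃ C : cs.SphericalCoset, (C : Set W) = {a, b} := by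
  constructor
  · intro h
    refine ⟨h.ne, ?_⟩
    obtain ⟨i, rfl⟩ := h
    refine ⟨⟨{a, a * cs.simple i}, a, {i}, ?_, ?_⟩, rfl⟩
    · rw [IsSpherical, specialSubgroup_singleton]; simp
    · rw [specialSubgroup_singleton, Set.smul_set_insert, Set.smul_set_singleton]; simp
  · rintro ⟨hne, ⟨_, w, T, hT, rfl⟩, hC⟩
    change w • (cs.specialSubgroup T : Set W) = {a, b} at hC
    rw [smul_specialSubgroup_eq (hC.symm ▸ Set.mem_insert a {b})] at hC
    have hb : a⁻¹ * b ∈ cs.specialSubgroup T := by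
      have : b ∈ a • (cs.specialSubgroup T : Set W) := by rw [hC]; simp
      rwa [Set.mem_smul_set_iff_inv_smul_mem] at this
    obtain ⟨t, ht, -⟩ := cs.exists_leftDescent_mem hb (by rwa [ne_eq, inv_mul_eq_one])
    have h2 : a * cs.simple t ∈ a • (cs.specialSubgroup T : Set W) :=
      Set.smul_mem_smul_set (cs.simple_mem_specialSubgroup ht)
    rw [hC] at h2
    have hadj : cs.cayleyGraph.Adj a (a * cs.simple t) := ⟨t, rfl⟩
    rcases h2 with h2 | h2
    · exact absurd h2 hadj.ne'
    · exact ⟨t, h2.symm⟩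

theorem exists_map_chambers (f : cs.DavisAut) :
    ∃ γ : W → W, ∀ (x : W) (C : cs.SphericalCoset),
      γ x ∈ ((f : Equiv.Perm cs.SphericalCoset) C : Set W) ↔ x ∈ (C : Set W) := by
  have (x : W) : ∃ y, cs.chamber y = (f : Equiv.Perm cs.SphericalCoset) '' cs.chamber x :=
    (f.2.2 _).2 ⟨x, rfl⟩
  choose γ hγ using this
  refine ⟨γ, fun x C => ?_⟩
  have := Set.ext_iff.1 (hγ x) ((f : Equiv.Perm cs.SphericalCoset) C)
  rwa [(Equiv.injective _).mem_set_image] at this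

/-- The vertex `{x}` lies in no chamber other than that of `x`. -/
theorem leftInverse_of_map_chambers {f : cs.DavisAut} {γ γ' : W → W}
    (h : ∀ (x : W) (C : cs.SphericalCoset),
      γ x ∈ ((f : Equiv.Perm cs.SphericalCoset) C : Set W) ↔ x ∈ (C : Set W))
    (h' : ∀ (x : W) (C : cs.SphericalCoset),
      γ' x ∈ ((f⁻¹ : Equiv.Perm cs.SphericalCoset) C : Set W) ↔ x ∈ (C : Set W)) :
    Function.LeftInverse γ' γ := by
  intro x
  have h1 := (h x (cs.point x)).2 rfl
  rw [← h', show (f⁻¹ : Equiv.Perm cs.SphericalCoset) ((f : Equiv.Perm cs.SphericalCoset)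
    (cs.point x)) = cs.point x from Equiv.symm_apply_apply _ _] at h1
  exact h1

theorem adj_of_map_chambers {f : cs.DavisAut} {γ : W → W} (hγ : Function.Bijective γ)
    (h : ∀ (x : W) (C : cs.SphericalCoset),
      γ x ∈ ((f : Equiv.Perm cs.SphericalCoset) C : Set W) ↔ x ∈ (C : Set W)) {a b : W} :
    cs.cayleyGraph.Adj (γ a) (γ b) ↔ cs.cayleyGraph.Adj a b := by
  rw [cayleyGraph_adj_iff, cayleyGraph_adj_iff, hγ.1.ne_iff]
  refine and_congr_right fun _ => ?_
  have key (C : cs.SphericalCoset) :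
      ((f : Equiv.Perm cs.SphericalCoset) C : Set W) = {γ a, γ b} ↔ (C : Set W) = {a, b} := by
    rw [Set.ext_iff, Set.ext_iff, hγ.2.forall]
    simp only [h, Set.mem_insert_iff, Set.mem_singleton_iff, hγ.1.eq_iff]
  rw [(Equiv.surjective (f : Equiv.Perm cs.SphericalCoset)).exists]
  simp only [key]

theorem toDavisAut_injective [Finite B] :
    Function.Injective (toDavisAut : cs.CayleyAut →* cs.DavisAut) := by
  intro g h e
  ext x
  have h1 := induces_toDavisAut g (cs.point x)
  rw [e, induces_toDavisAut h] at h1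
  simpa [point] using h1.symm

theorem toDavisAut_surjective [Finite B] :
    Function.Surjective (toDavisAut : cs.CayleyAut →* cs.DavisAut) := by
  intro f
  obtain ⟨γ, h⟩ := exists_map_chambers f
  obtain ⟨γ', h'⟩ := exists_map_chambers f⁻¹
  have hl : Function.LeftInverse γ' γ := leftInverse_of_map_chambers h h'
  have hr : Function.LeftInverse γ γ' := leftInverse_of_map_chambers (f := f⁻¹) h' (by simpa using h)
  refine ⟨⟨⟨γ, γ', hl, hr⟩, adj_of_map_chambers ⟨hl.injective, hr.surjective⟩ h⟩, ?_⟩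
  ext C y
  obtain ⟨x, rfl⟩ := hr.surjective y
  rw [induces_toDavisAut, h]
  exact hl.injective.mem_set_image

/-- The automorphism groups of the Cayley graph and of the Davis complex are isomorphic. -/
noncomputable def davisAutEquiv [Finite B] : cs.CayleyAut ≃* cs.DavisAut :=
  MulEquiv.ofBijective toDavisAut ⟨toDavisAut_injective, toDavisAut_surjective⟩

theorem induces_davisAutEquiv [Finite B] (g : cs.CayleyAut) : Induces g (davisAutEquiv g) :=
  induces_toDavisAut g

theorem induces_iff [Finite B] {g : cs.CayleyAut} {f : cs.DavisAut} :
    Induces g f ↔ f = davisAutEquiv g := by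
  constructor
  · intro h
    ext C : 2
    exact Subtype.ext ((h C).trans (induces_davisAutEquiv g C).symm)
  · rintro rfl
    exact induces_davisAutEquiv g

theorem inducedSubgroup_eq_map [Finite B] (H : Subgroup cs.CayleyAut) :
    cs.inducedSubgroup H = H.map (davisAutEquiv : cs.CayleyAut ≃* cs.DavisAut).toMonoidHom := by
  ext f
  change (∃ g ∈ H, Induces g f) ↔ _
  simp only [induces_iff, Subgroup.mem_map]
  exact exists_congr fun g => and_congr_right fun _ => eq_comm

end CoxeterSystem

namespace CoxeterSystem

variable {B W : Type*} [Group W] {M : CoxeterMatrix B} {cs : CoxeterSystem M W}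

/-! ### Standard automorphisms of the Cayley graph -/

variable (cs) in
theorem diagramAut_liftable (φ : M.diagramAut) :
    M.IsLiftable fun i => cs.simple ((φ : Equiv.Perm B) i) := fun i j => by
  rw [← φ.2 i j, cs.simple_mul_simple_pow]

variable (cs) in
/-- The group automorphism of `W` extending a diagram automorphism. -/
noncomputable def diagramMulAut (φ : M.diagramAut) : W ≃* W :=
  MonoidHom.toMulEquiv (cs.lift ⟨_, cs.diagramAut_liftable φ⟩)
    (cs.lift ⟨_, cs.diagramAut_liftable φ⁻¹⟩)
    (cs.ext_simple fun i => by simp [lift_apply_simple])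
    (cs.ext_simple fun i => by simp [lift_apply_simple])

theorem diagramMulAut_simple (φ : M.diagramAut) (i : B) :
    cs.diagramMulAut φ (cs.simple i) = cs.simple ((φ : Equiv.Perm B) i) :=
  cs.lift_apply_simple _ i

theorem mulEquiv_eq_of_simple {α β : W ≃* W} (h : ∀ i, α (cs.simple i) = β (cs.simple i)) :
    α = β :=
  MulEquiv.toMonoidHom_injective (cs.ext_simple h)

theorem diagramMulAut_inv (φ : M.diagramAut) :
    cs.diagramMulAut φ⁻¹ = (cs.diagramMulAut φ).symm := by
  refine mulEquiv_eq_of_simple (cs := cs) fun i => ?_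
  rw [MulEquiv.eq_symm_apply, diagramMulAut_simple, diagramMulAut_simple]
  simp

variable (cs) in
/-- The left multiplications, as automorphisms of the Cayley graph. -/
def leftMulAut (w : W) : cs.CayleyAut where
  toEquiv := Equiv.mulLeft w
  map_rel_iff' {a b} := by
    change (∃ i, w * b = w * a * cs.simple i) ↔ ∃ i, b = a * cs.simple i
    simp only [mul_assoc, mul_right_inj]

theorem leftMulAut_mem (w : W) : cs.leftMulAut w ∈ cs.cayleyLeftMul := ⟨w, fun _ => rfl⟩

theorem diagramMulAut_adj (φ : M.diagramAut) {a b : W} (h : cs.cayleyGraph.Adj a b) :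
    cs.cayleyGraph.Adj (cs.diagramMulAut φ a) (cs.diagramMulAut φ b) := by
  obtain ⟨i, rfl⟩ := h
  exact ⟨_, by rw [map_mul, diagramMulAut_simple]⟩

variable (cs) in
/-- The diagram automorphisms of the Cayley graph. -/
noncomputable def diagramCayleyAut (φ : M.diagramAut) : cs.CayleyAut where
  toEquiv := (cs.diagramMulAut φ).toEquiv
  map_rel_iff' {a b} := by
    refine ⟨fun h => ?_, diagramMulAut_adj φ⟩
    simpa [diagramMulAut_inv] using diagramMulAut_adj φ⁻¹ h

theorem diagramCayleyAut_apply (φ : M.diagramAut) (x : W) :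
    cs.diagramCayleyAut φ x = cs.diagramMulAut φ x := rfl

theorem diagramCayleyAut_mem (φ : M.diagramAut) : cs.diagramCayleyAut φ ∈ cs.cayleyDiagram :=
  ⟨φ, φ.2, cs.diagramMulAut φ, diagramMulAut_simple φ, fun _ => rfl⟩

theorem length_diagramMulAut (φ : M.diagramAut) (x : W) :
    cs.length (cs.diagramMulAut φ x) = cs.length x := by
  simpa [diagramCayleyAut_apply] using length_inv_mul_map (cs.diagramCayleyAut φ) 1 x

/-! ### Local types of automorphisms of the Cayley graph -/

theorem localPerm_mul_simple_self (g : cs.CayleyAut) (v : W) (i : B) :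
    localPerm g (v * cs.simple i) i = localPerm g v i := by
  apply localPerm_eq
  rw [simple_mul_simple_cancel_right, map_mul_simple_localPerm, simple_mul_simple_cancel_right]

/-- The image of the finite dihedral coset at `v` is again such a coset, with labels `localPerm g v
i` and `localPerm g v j`. At the neighbouring vertex the first label belongs to the edge back to
`v`, which leaves only the second for `j`. -/
theorem localPerm_mul_simple_of_ne_zero [Finite B] (g : cs.CayleyAut) (v : W) {i j : B}
    (h : M i j ≠ 0) : localPerm g (v * cs.simple i) j = localPerm g v j := by
  by_cases hij : i = j
  · rw [hij, localPerm_mul_simple_self]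
  have hs := (cs.isSpherical_pair h).image_smul g v
  have hmem : v * cs.simple i * cs.simple j ∈ v • (cs.specialSubgroup {i, j} : Set W) := by
    rw [mul_assoc]
    exact Set.smul_mem_smul_set (mul_mem (cs.simple_mem_specialSubgroup (by simp))
      (cs.simple_mem_specialSubgroup (by simp)))
  have h2 := Set.mem_image_of_mem g hmem
  rw [hs, map_mul_simple_localPerm, map_mul_simple_localPerm, Set.mem_smul_set_iff_inv_smul_mem,
    smul_eq_mul, mul_assoc, inv_mul_cancel_left, SetLike.mem_coe, Subgroup.mul_mem_cancel_left _
    (cs.simple_mem_specialSubgroup (Set.mem_image_of_mem _ (by simp))),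
    simple_mem_specialSubgroup_iff, Set.image_pair] at h2
  rcases h2 with h2 | h2
  · rw [← localPerm_mul_simple_self g v i] at h2
    exact absurd ((localPerm g _).injective h2).symm hij
  · exact h2

theorem map_mul_pow_of_ne_zero [Finite B] (g : cs.CayleyAut) (v : W) {i j : B}
    (h : M i j ≠ 0) (k : ℕ) :
    let i' := localPerm g v i
    let j' := localPerm g v j
    g (v * (cs.simple i * cs.simple j) ^ k) = g v * (cs.simple i' * cs.simple j') ^ k ∧
      localPerm g (v * (cs.simple i * cs.simple j) ^ k) i = i' ∧
      localPerm g (v * (cs.simple i * cs.simple j) ^ k) j = j' := by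
  intro i' j'
  induction k with
  | zero => simp [i', j']
  | succ k ih =>
    obtain ⟨h1, h2, h3⟩ := ih
    have h' : M j i ≠ 0 := by rwa [M.symmetric]
    set x := v * (cs.simple i * cs.simple j) ^ k with hx
    have e : v * (cs.simple i * cs.simple j) ^ (k + 1) = x * cs.simple i * cs.simple j := by
      rw [pow_succ, hx]; simp only [mul_assoc]
    rw [e, localPerm_mul_simple_self, localPerm_mul_simple_of_ne_zero g _ h',
      localPerm_mul_simple_of_ne_zero g _ h, localPerm_mul_simple_self,
      map_mul_simple_localPerm, map_mul_simple_localPerm, localPerm_mul_simple_of_ne_zero g _ h,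
      h1, h2, h3, pow_succ]
    simp only [mul_assoc, and_self]

/-- A path alternating between `i` and `j` is mapped to one alternating between their images, and
the two close up after the same numbers of steps. -/
theorem matrix_localPerm_of_ne_zero [Finite B] (g : cs.CayleyAut) (v : W) {i j : B}
    (h : M i j ≠ 0) : M (localPerm g v i) (localPerm g v j) = M i j := by
  rw [← cs.orderOf_simple_mul_simple, ← cs.orderOf_simple_mul_simple]
  refine orderOf_eq_orderOf_iff.2 fun k => ?_
  rw [← mul_right_inj (g v), ← (map_mul_pow_of_ne_zero g v h k).1, mul_one, g.injective.eq_iff,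
    mul_eq_left]

theorem localPerm_mem_diagramAut [Finite B] (g : cs.CayleyAut) (v : W) :
    localPerm g v ∈ M.diagramAut := by
  intro i j
  by_cases h : M i j = 0
  -- Infinite entries follow from the finite case applied to the inverse automorphism.
  · by_contra h'
    rw [h] at h'
    have := matrix_localPerm_of_ne_zero g.symm (g v) h'
    rw [localPerm_symm, Equiv.symm_apply_apply, Equiv.symm_apply_apply, h] at this
    exact h' this.symm
  · exact matrix_localPerm_of_ne_zero g v h

/-- If the diagram is not flexible, then all automorphisms of the Cayley graph are standard. -/
theorem exists_eq_mul_diagramMulAut [Finite B] (hM : ¬ M.IsFlexible) (g : cs.CayleyAut) :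
    ∃ (w : W) (φ : M.diagramAut), ∀ x, g x = w * cs.diagramMulAut φ x := by
  have hstep (v : W) (i : B) : localPerm g (v * cs.simple i) = localPerm g v := by
    by_contra hne
    -- A change of local permutation across an `i`-edge fixes `i` and all its neighbours, so a
    -- nontrivial change would witness flexibility at `i`.
    refine hM ⟨i, (localPerm g v)⁻¹ * localPerm g (v * cs.simple i),
      mul_mem (inv_mem (localPerm_mem_diagramAut g v)) (localPerm_mem_diagramAut g _), ?_, ?_, ?_⟩
    · rw [ne_eq, inv_mul_eq_one]
      exact fun h => hne h.symm
    · rw [Equiv.Perm.mul_apply, Equiv.Perm.inv_eq_iff_eq, localPerm_mul_simple_self]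
    · intro t ht
      rw [Equiv.Perm.mul_apply, Equiv.Perm.inv_eq_iff_eq, localPerm_mul_simple_of_ne_zero g v ht.2]
  have hconst (v : W) : localPerm g v = localPerm g 1 := by
    induction v using cs.simple_induction_right with
    | one => rfl
    | mul_simple_right v i ih => rw [hstep, ih]
  refine ⟨g 1, ⟨localPerm g 1, localPerm_mem_diagramAut g 1⟩, fun x => ?_⟩
  induction x using cs.simple_induction_right with
  | one => simp
  | mul_simple_right x i ih =>
    rw [map_mul_simple_localPerm, hconst, ih, map_mul, diagramMulAut_simple, mul_assoc]

/-! ### Twists along a star -/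

/-- Stripping left descents in `T` off `z` ends at the shortest element of `W_T z`. -/
theorem exists_eq_mul_forall_not_isLeftDescent (T : Set B) (z : W) :
    ∃ c ∈ cs.specialSubgroup T, ∃ y, z = c * y ∧ ∀ t ∈ T, ¬ cs.IsLeftDescent y t := by
  induction hn : cs.length z using Nat.strong_induction_on generalizing z with
  | _ n ih =>
    by_cases h : ∀ t ∈ T, ¬ cs.IsLeftDescent z t
    · exact ⟨1, one_mem _, z, (one_mul z).symm, h⟩
    push Not at h
    obtain ⟨t, ht, hd⟩ := h
    obtain ⟨c, hc, y, e, hy⟩ := ih (cs.length (cs.simple t * z)) (hn ▸ (show _ < _ from hd)) _ rfl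
    refine ⟨cs.simple t * c, mul_mem (cs.simple_mem_specialSubgroup ht) hc, y, ?_, hy⟩
    rw [mul_assoc, ← e, simple_mul_simple_cancel_left]

variable (cs) in
/-- The intersection of the half-spaces which are bounded by the translates of the wall of `s` under
the special subgroup of the link of `s`, and contain the identity. -/
def linkChamber (s : B) : Set W :=
  {x | ∀ l ∈ cs.specialSubgroup (M.definingDiagram.neighborSet s), ¬ cs.IsLeftDescent (l * x) s}

theorem not_mem_linkChamber {s : B} {x : W} (h : cs.IsLeftDescent x s) :
    x ∉ cs.linkChamber s :=
  fun hx => hx 1 (one_mem _) (by rwa [one_mul])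

theorem eq_zero_of_not_adj {s r : B} (h : r ≠ s) (h' : ¬ M.definingDiagram.Adj s r) :
    M s r = 0 := by
  by_contra h0
  exact h' ⟨h.symm, h0⟩

/-- An edge leaving the link chamber starts in the special subgroup of the link. -/
theorem mem_specialSubgroup_of_linkChamber_boundary [Finite B] {s t : B} {x : W}
    (hx : x ∈ cs.linkChamber s) (hxt : x * cs.simple t ∉ cs.linkChamber s) :
    x ∈ cs.specialSubgroup (M.definingDiagram.neighborSet s) := by
  set N := M.definingDiagram.neighborSet s with hN
  set T := insert s N with hT
  have hsub : cs.specialSubgroup N ≤ cs.specialSubgroup T :=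
    Subgroup.closure_mono (Set.image_mono (Set.subset_insert s N))
  have hsN : s ∉ N := fun h => h.1 rfl
  simp only [linkChamber, Set.mem_ofPred_eq, not_forall, not_not] at hxt
  obtain ⟨l, hl, hd⟩ := hxt
  rw [← mul_assoc] at hd
  have e := cs.simple_mul_eq_mul_simple (hx l hl) hd
  obtain ⟨c, hc, y, hz, hy⟩ := exists_eq_mul_forall_not_isLeftDescent (cs := cs) N (l * x)
  rw [hz] at e
  have hy' : ∀ p ∈ T, ¬ cs.IsLeftDescent y p := by
    rintro p (rfl | hp)
    · have : y = c⁻¹ * l * x := by rw [mul_assoc, hz, inv_mul_cancel_left]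
      rw [this]
      exact hx _ (mul_mem (inv_mem hc) hl)
    · exact hy p hp
  have hρ : c⁻¹ * cs.simple s * c ∈ cs.specialSubgroup T :=
    mul_mem (mul_mem (inv_mem (hsub hc)) (cs.simple_mem_specialSubgroup (Set.mem_insert s N)))
      (hsub hc)
  have hρy : c⁻¹ * cs.simple s * c * y = y * cs.simple t := by
    rw [mul_assoc, mul_assoc, e, mul_assoc, inv_mul_cancel_left]
  -- Otherwise `y` and `y * s t` would both be shortest in the same coset of `W_T`, although their
  -- lengths differ.
  have hex : ∃ p ∈ T, cs.IsLeftDescent (y * cs.simple t) p := by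
    by_contra hcon
    push Not at hcon
    have h1 := cs.length_mul_of_forall_not_isLeftDescent hy' hρ
    have h2 := cs.length_mul_of_forall_not_isLeftDescent hcon (inv_mem hρ)
    rw [← hρy, inv_mul_cancel_left, hρy] at h2
    rw [hρy] at h1
    exact cs.length_mul_simple_ne y t (by omega)
  obtain ⟨p, hpT, hp⟩ := hex
  have hpy := cs.simple_mul_eq_mul_simple (hy' p hpT) hp
  have hpρ : cs.simple p = c⁻¹ * cs.simple s * c := mul_right_cancel (hpy.trans hρy.symm)
  have hps : p = s := by
    refine hpT.resolve_right fun hpN => hsN ?_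
    rw [← cs.simple_mem_specialSubgroup_iff]
    have : cs.simple s = c * cs.simple p * c⁻¹ := by rw [hpρ]; group
    rw [this]
    exact mul_mem (mul_mem hc (cs.simple_mem_specialSubgroup hpN)) (inv_mem hc)
  subst hps
  -- A left descent `r` of `y` lies outside `T`, so `m = ∞` for it and the vertex `p`; yet both
  -- would be left descents of `y * s t`.
  have hy1 : y = 1 := by
    by_contra hne
    obtain ⟨r, hr⟩ := cs.exists_leftDescent_of_ne_one hne
    have hrT : r ∉ T := fun h => hy' r h hr
    have h0 : M p r = 0 := eq_zero_of_not_adj (fun h => hrT (h ▸ Set.mem_insert _ _))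
      (fun h => hrT (Set.mem_insert_of_mem _ h))
    refine cs.not_isLeftDescent_of_eq_zero h0 hp ?_
    have h1 := cs.not_isLeftDescent_iff.1 (hy' p hpT)
    have h2 := cs.length_mul_le (cs.simple r * y) (cs.simple t)
    have h3 := cs.isLeftDescent_iff.1 hr
    rw [hpy] at h1
    rw [length_simple] at h2
    rw [IsLeftDescent, ← mul_assoc]
    omega
  rw [hy1, mul_one] at hz
  exact (Subgroup.mul_mem_cancel_left _ hl).1 (hz ▸ hc)

/-- The diagram automorphisms that fix a vertex and its neighbours. -/
def starFixer (M : CoxeterMatrix B) (s : B) : Set M.diagramAut :=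
  {φ | (φ : Equiv.Perm B) s = s ∧ ∀ t, M.definingDiagram.Adj s t → (φ : Equiv.Perm B) t = t}

theorem inv_mem_starFixer {s : B} {φ : M.diagramAut} (h : φ ∈ starFixer M s) :
    φ⁻¹ ∈ starFixer M s :=
  ⟨Equiv.Perm.inv_eq_iff_eq.2 h.1.symm, fun t ht => Equiv.Perm.inv_eq_iff_eq.2 (h.2 t ht).symm⟩

theorem diagramMulAut_eq_self {s : B} {φ : M.diagramAut} (h : φ ∈ starFixer M s) {x : W}
    (hx : x ∈ cs.specialSubgroup (M.definingDiagram.neighborSet s)) :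
    cs.diagramMulAut φ x = x := by
  induction hx using Subgroup.closure_induction with
  | mem x hx =>
    obtain ⟨t, ht, rfl⟩ := hx
    rw [diagramMulAut_simple, h.2 t ht]
  | one => exact map_one _
  | mul x y _ _ hx hy => rw [map_mul, hx, hy]
  | inv x _ hx => rw [map_inv, hx]

/-- The automorphism preserves lengths and fixes both `s` and the elements `l` that define the
half-spaces. -/
theorem diagramMulAut_mem_linkChamber {s : B} {φ : M.diagramAut} (h : φ ∈ starFixer M s) {x : W}
    (hx : x ∈ cs.linkChamber s) : cs.diagramMulAut φ x ∈ cs.linkChamber s := by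
  intro l hl hd
  refine hx l hl ?_
  rw [IsLeftDescent, ← length_diagramMulAut φ, ← length_diagramMulAut φ (l * x)]
  rwa [map_mul, map_mul, diagramMulAut_simple, h.1, diagramMulAut_eq_self h hl]

open Classical in
variable (cs) in
/-- The diagram automorphism `φ` on the link chamber of `s`, and the identity elsewhere. -/
noncomputable def twistFun (s : B) (φ : M.diagramAut) (x : W) : W :=
  if x ∈ cs.linkChamber s then cs.diagramMulAut φ x else x

theorem twistFun_of_mem {s : B} (φ : M.diagramAut) {x : W} (hx : x ∈ cs.linkChamber s) :
    cs.twistFun s φ x = cs.diagramMulAut φ x := if_pos hx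

theorem twistFun_of_not_mem {s : B} (φ : M.diagramAut) {x : W} (hx : x ∉ cs.linkChamber s) :
    cs.twistFun s φ x = x := if_neg hx

theorem twistFun_inv_twistFun {s : B} {φ : M.diagramAut} (h : φ ∈ starFixer M s) (x : W) :
    cs.twistFun s φ⁻¹ (cs.twistFun s φ x) = x := by
  by_cases hx : x ∈ cs.linkChamber s
  · rw [twistFun_of_mem _ hx, twistFun_of_mem _ (diagramMulAut_mem_linkChamber h hx),
      diagramMulAut_inv, MulEquiv.symm_apply_apply]
  · rw [twistFun_of_not_mem _ hx, twistFun_of_not_mem _ hx]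

theorem twistFun_adj [Finite B] {s : B} {φ : M.diagramAut} (h : φ ∈ starFixer M s) {a b : W}
    (hab : cs.cayleyGraph.Adj a b) :
    cs.cayleyGraph.Adj (cs.twistFun s φ a) (cs.twistFun s φ b) := by
  have key {a b : W} (hab : cs.cayleyGraph.Adj a b) (ha : a ∈ cs.linkChamber s)
      (hb : b ∉ cs.linkChamber s) : cs.cayleyGraph.Adj (cs.twistFun s φ a) (cs.twistFun s φ b) := by
    rw [twistFun_of_mem φ ha, twistFun_of_not_mem φ hb]
    obtain ⟨t, rfl⟩ := id hab
    rwa [diagramMulAut_eq_self h (mem_specialSubgroup_of_linkChamber_boundary ha hb)]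
  by_cases ha : a ∈ cs.linkChamber s <;> by_cases hb : b ∈ cs.linkChamber s
  · rw [twistFun_of_mem φ ha, twistFun_of_mem φ hb]
    exact diagramMulAut_adj φ hab
  · exact key hab ha hb
  · exact (key hab.symm hb ha).symm
  · rwa [twistFun_of_not_mem φ ha, twistFun_of_not_mem φ hb]

/-- The twist, as an automorphism of the Cayley graph. -/
noncomputable def twist [Finite B] {s : B} {φ : M.diagramAut} (h : φ ∈ starFixer M s) :
    cs.CayleyAut where
  toFun := cs.twistFun s φ
  invFun := cs.twistFun s φ⁻¹
  left_inv := twistFun_inv_twistFun h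
  right_inv x := by simpa using twistFun_inv_twistFun (inv_mem_starFixer h) x
  map_rel_iff' {a b} := by
    refine ⟨fun hab => ?_, twistFun_adj h⟩
    have := twistFun_adj (inv_mem_starFixer h) hab
    simpa only [Equiv.coe_fn_mk, twistFun_inv_twistFun h] using this

theorem twist_apply [Finite B] {s : B} {φ : M.diagramAut} (h : φ ∈ starFixer M s) (x : W) :
    twist (cs := cs) h x = cs.twistFun s φ x := rfl

/-! ### Nontriviality of the twists and of their translates -/

theorem simple_mem_linkChamber {s r : B} (h : r ≠ s) : cs.simple r ∈ cs.linkChamber s := by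
  intro l hl hd
  have hm : l * cs.simple r ∈ cs.specialSubgroup (insert r (M.definingDiagram.neighborSet s)) :=
    mul_mem (Subgroup.closure_mono (Set.image_mono (Set.subset_insert _ _)) hl)
      (cs.simple_mem_specialSubgroup (Set.mem_insert _ _))
  rcases cs.mem_of_isLeftDescent hm hd with h' | h'
  exacts [h h'.symm, h'.1 rfl]

/-- The ping-pong step: `s` and `r` are never simultaneous descents, so creating the descent `r`
excludes `s`, and multiplying by `s` then creates the descent `s`. -/
theorem isLeftDescent_mul_mul_of_eq_zero [Finite B] {s r : B} (h : M s r = 0) {x : W}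
    (hx : ¬ cs.IsLeftDescent x r) : cs.IsLeftDescent (cs.simple s * (cs.simple r * x)) s :=
  cs.isLeftDescent_simple_mul fun hs =>
    cs.not_isLeftDescent_of_eq_zero h hs (cs.isLeftDescent_simple_mul hx)

theorem isLeftDescent_pow_mul_of_isLeftDescent [Finite B] {s r : B} (h : M s r = 0) {x : W}
    (hx : cs.IsLeftDescent x s) (n : ℕ) :
    cs.IsLeftDescent ((cs.simple s * cs.simple r) ^ n * x) s := by
  induction n with
  | zero => simpa
  | succ n ih =>
    rw [pow_succ', mul_assoc, mul_assoc]
    exact isLeftDescent_mul_mul_of_eq_zero h (cs.not_isLeftDescent_of_eq_zero h ih)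

/-- Multiplying by a high power of `s r` moves elements behind the wall of `s`, if `m s r = ∞`. -/
theorem isLeftDescent_pow_mul [Finite B] {s r : B} (h : M s r = 0) (n : ℕ) {x : W}
    (hx : cs.length x < n) : cs.IsLeftDescent ((cs.simple s * cs.simple r) ^ n * x) s := by
  induction n generalizing x with
  | zero => omega
  | succ n ih =>
    rw [pow_succ, mul_assoc, mul_assoc]
    -- If `s` is not yet a descent, both multiplications shortened `x`, so the length dropped by
    -- two; otherwise ping-pong keeps the descent.
    by_cases hs : cs.IsLeftDescent (cs.simple s * (cs.simple r * x)) s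
    · exact isLeftDescent_pow_mul_of_isLeftDescent h hs n
    · apply ih
      have h1 : cs.IsLeftDescent x r := by
        by_contra hr
        exact hs (isLeftDescent_mul_mul_of_eq_zero h hr)
      have h2 := cs.isLeftDescent_iff.1 h1
      rw [isLeftDescent_iff_not_isLeftDescent_mul, not_not, simple_mul_simple_cancel_left] at hs
      have h3 := cs.isLeftDescent_iff.1 hs
      omega

theorem IsFlexible.exists_starFixer (hM : M.IsFlexible) :
    ∃ (s r : B) (φ : M.diagramAut), φ ∈ starFixer M s ∧ (φ : Equiv.Perm B) r ≠ r ∧ r ≠ s ∧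
      M s r = 0 := by
  obtain ⟨s, φ, hφ, hne, hs, hadj⟩ := hM
  obtain ⟨r, hr⟩ : ∃ r, φ r ≠ r := by
    by_contra hcon
    push Not at hcon
    exact hne (Equiv.ext hcon)
  have hrs : r ≠ s := fun h => hr (h ▸ hs)
  exact ⟨s, r, ⟨φ, hφ⟩, ⟨hs, hadj⟩, hr, hrs, eq_zero_of_not_adj hrs fun h => hr (hadj r h)⟩

/-- If the diagram is flexible, then the Cayley graph has nonstandard automorphisms. -/
theorem exists_ne_mul_of_isFlexible [Finite B] (hM : M.IsFlexible) :
    ∃ g : cs.CayleyAut, ∀ l ∈ cs.cayleyLeftMul, ∀ d ∈ cs.cayleyDiagram, g ≠ l * d := by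
  obtain ⟨s, r, φ, hφ, hr, hrs, h0⟩ := IsFlexible.exists_starFixer hM
  refine ⟨twist hφ, ?_⟩
  rintro l ⟨w, hl⟩ d ⟨ψ, -, β, hβ, hd⟩ e
  have key (x : W) : cs.twistFun s φ x = w * β x := by
    rw [← twist_apply hφ, e, RelIso.mul_apply, hl, hd]
  have hs : cs.IsLeftDescent (cs.simple s) s := by simp [IsLeftDescent]
  have hsr : cs.IsLeftDescent (cs.simple s * cs.simple r) s := by
    simpa using isLeftDescent_mul_mul_of_eq_zero h0 (cs.not_isLeftDescent_one r)
  -- The twist fixes `1`, `s` and `s * r` but moves `r`. A left multiplication after a group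
  -- automorphism that fixes the first three also fixes `r`.
  have h1 := key 1
  have h2 := key (cs.simple s)
  have h3 := key (cs.simple r)
  have h4 := key (cs.simple s * cs.simple r)
  have hw : w = 1 := by
    by_cases h : (1 : W) ∈ cs.linkChamber s
    · rw [twistFun_of_mem _ h, map_one, map_one, mul_one] at h1
      exact h1.symm
    · rw [twistFun_of_not_mem _ h, map_one, mul_one] at h1
      exact h1.symm
  rw [hw, one_mul] at h2 h3 h4
  rw [twistFun_of_not_mem _ (not_mem_linkChamber hs)] at h2
  rw [twistFun_of_not_mem _ (not_mem_linkChamber hsr), map_mul, ← h2, mul_right_inj] at h4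
  rw [twistFun_of_mem _ (simple_mem_linkChamber hrs), diagramMulAut_simple, ← h4] at h3
  exact hr (cs.simple_injective h3)

/-- If the diagram is flexible, then the pointwise stabilizers of balls in the automorphism group of
the Cayley graph are nontrivial. -/
theorem exists_ne_one_of_isFlexible [Finite B] (hM : M.IsFlexible) (n : ℕ) :
    ∃ g : cs.CayleyAut, g ≠ 1 ∧ ∀ x, cs.length x < n → g x = x := by
  obtain ⟨s, r, φ, hφ, hr, hrs, h0⟩ := IsFlexible.exists_starFixer hM
  set u := (cs.simple s * cs.simple r) ^ n with hu
  -- Translation by `u` carries the ball behind the wall of `s`, where the twist is the identity.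
  refine ⟨(cs.leftMulAut u)⁻¹ * twist hφ * cs.leftMulAut u, fun h => ?_, fun x hx => ?_⟩
  · rw [mul_assoc, inv_mul_eq_one] at h
    have h1 : (1 : cs.CayleyAut) = twist hφ := (mul_eq_right.1 h.symm).symm
    have h2 : cs.simple r = twist (cs := cs) hφ (cs.simple r) := by rw [← h1]; rfl
    rw [twist_apply, twistFun_of_mem _ (simple_mem_linkChamber hrs), diagramMulAut_simple] at h2
    exact hr (cs.simple_injective h2).symm
  · apply (cs.leftMulAut u).injective
    rw [RelIso.mul_apply, RelIso.mul_apply, RelIso.apply_inv_self, twist_apply,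
      twistFun_of_not_mem _ (not_mem_linkChamber _)]
    exact isLeftDescent_pow_mul h0 n hx

end CoxeterSystem

namespace CoxeterSystem

variable {B W : Type*} [Group W] {M : CoxeterMatrix B} {cs : CoxeterSystem M W}

/-! ### The topology -/

theorem isFlexible_imp_not_discreteTopology [Finite B] (hM : M.IsFlexible) :
    ¬ DiscreteTopology cs.DavisAut := by
  intro hd
  let : TopologicalSpace cs.SphericalCoset := ⊥
  obtain ⟨U, hU, hU1⟩ := isOpen_induced_iff.1 (isOpen_discrete ({1} : Set cs.DavisAut))
  have hmem : (fun v => v) ∈ U := by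
    have : (1 : cs.DavisAut) ∈ ({1} : Set cs.DavisAut) := rfl
    rw [← hU1] at this
    exact this
  obtain ⟨I, u, hu, hIU⟩ := isOpen_pi_iff.1 hU _ hmem
  -- A basic neighbourhood of `1` constrains finitely many finite cosets, all inside one ball; an
  -- automorphism fixing that ball pointwise lies in the neighbourhood.
  have hfin : (⋃ C ∈ I, (C : Set W)).Finite := by
    refine Set.Finite.biUnion I.finite_toSet fun C _ => ?_
    obtain ⟨_, w, T, hT, rfl⟩ := C
    exact hT.smul_set
  obtain ⟨n, hn⟩ := (hfin.image cs.length).bddAbove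
  obtain ⟨g, hg, hfix⟩ := exists_ne_one_of_isFlexible (cs := cs) hM (n + 1)
  refine hg (toDavisAut_injective ?_)
  rw [map_one]
  have h1 : toDavisAut g ∈ ({1} : Set cs.DavisAut) := by
    rw [← hU1]
    refine hIU fun C hC => ?_
    have : (toDavisAut g : Equiv.Perm cs.SphericalCoset) C = C := by
      refine Subtype.ext ((induces_toDavisAut g C).trans ?_)
      refine (Set.image_congr fun x hx => hfix x ?_).trans (Set.image_id _)
      exact Nat.lt_succ_of_le (hn (Set.mem_image_of_mem _ (Set.mem_biUnion hC hx)))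
    change (toDavisAut g : Equiv.Perm cs.SphericalCoset) C ∈ u C
    rw [this]
    exact (hu C hC).2
  exact h1

theorem discreteTopology_of_not_isFlexible [Finite B] (hM : ¬ M.IsFlexible) :
    DiscreteTopology cs.DavisAut := by
  let : TopologicalSpace cs.SphericalCoset := ⊥
  have : DiscreteTopology cs.SphericalCoset := ⟨rfl⟩
  rw [discreteTopology_iff_isOpen_singleton]
  intro f
  -- The value at `1` determines the left multiplication, and then the values at the generators
  -- determine the diagram automorphism.
  have hfin : (insert (cs.point 1) (Set.range fun i => cs.point (cs.simple i))).Finite :=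
    (Set.finite_range _).insert _
  refine isOpen_induced_iff.2 ⟨_, isOpen_set_pi
    (s := fun C => {(f : Equiv.Perm cs.SphericalCoset) C}) hfin fun C _ => isOpen_discrete _, ?_⟩
  ext f'
  constructor
  · intro hf'
    obtain ⟨g, rfl⟩ := toDavisAut_surjective f
    obtain ⟨g', rfl⟩ := toDavisAut_surjective f'
    have key {x : W}
        (hx : cs.point x ∈ insert (cs.point 1) (Set.range fun i => cs.point (cs.simple i))) :
        g' x = g x := by
      have h1 : (toDavisAut g' : Equiv.Perm cs.SphericalCoset) (cs.point x) =
        (toDavisAut g : Equiv.Perm cs.SphericalCoset) (cs.point x) := hf' _ hx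
      have h2 := congrArg (Subtype.val) h1
      rw [induces_toDavisAut, induces_toDavisAut] at h2
      simpa [point] using h2
    obtain ⟨w, φ, hg⟩ := exists_eq_mul_diagramMulAut hM g
    obtain ⟨w', φ', hg'⟩ := exists_eq_mul_diagramMulAut hM g'
    have hw : w' = w := by
      simpa [hg, hg'] using key (Set.mem_insert _ _)
    have hφ : cs.diagramMulAut φ' = cs.diagramMulAut φ :=
      mulEquiv_eq_of_simple (cs := cs) fun i => by
        simpa [hg, hg', hw] using key (Set.mem_insert_of_mem _ ⟨i, rfl⟩)
    have : g' = g := by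
      ext x
      rw [hg, hg', hw, hφ]
    rw [this]
    rfl
  · rintro rfl
    exact fun C _ => rfl

/-! ### Left multiplications and diagram automorphisms -/

theorem forall_exists_mul_iff [Finite B] :
    (∀ g : cs.CayleyAut, ∃ l ∈ cs.cayleyLeftMul, ∃ d ∈ cs.cayleyDiagram, g = l * d) ↔
      ¬ M.IsFlexible := by
  constructor
  · intro h hM
    obtain ⟨g, hg⟩ := exists_ne_mul_of_isFlexible (cs := cs) hM
    obtain ⟨l, hl, d, hd, e⟩ := h g
    exact hg l hl d hd e
  · intro hM g
    obtain ⟨w, φ, hg⟩ := exists_eq_mul_diagramMulAut hM g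
    refine ⟨_, leftMulAut_mem w, _, diagramCayleyAut_mem φ, ?_⟩
    ext x
    rw [hg]
    rfl

theorem disjoint_cayleyLeftMul_cayleyDiagram :
    Disjoint cs.cayleyLeftMul cs.cayleyDiagram := by
  rw [Subgroup.disjoint_def]
  rintro g ⟨w, hw⟩ ⟨φ, -, α, -, hα⟩
  have h1 : w = 1 := by
    have := hw 1
    rwa [hα, map_one, mul_one, eq_comm] at this
  ext x
  rw [hw, h1, one_mul]
  rfl

/-- Conjugating left multiplication by `w` with a group automorphism `α` gives left multiplication
by `α w`. -/
theorem cayleyDiagram_le_normalizer :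
    cs.cayleyDiagram ≤ Subgroup.normalizer (cs.cayleyLeftMul : Set cs.CayleyAut) := by
  have key {g d : cs.CayleyAut} (hg : g ∈ cs.cayleyLeftMul) (hd : d ∈ cs.cayleyDiagram) :
      d * g * d⁻¹ ∈ cs.cayleyLeftMul := by
    obtain ⟨w, hw⟩ := hg
    obtain ⟨φ, -, α, -, hα⟩ := hd
    refine ⟨α w, fun x => ?_⟩
    obtain ⟨x, rfl⟩ := d.surjective x
    rw [RelIso.mul_apply, RelIso.mul_apply, RelIso.inv_apply_self, hw, hα, hα, map_mul]
  intro d hd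
  rw [Subgroup.mem_normalizer_iff]
  refine fun g => ⟨fun hg => key hg hd, fun hg => ?_⟩
  have := key hg (inv_mem hd)
  simpa [mul_assoc] using this

theorem normal_cayleyLeftMul
    (h : ∀ g : cs.CayleyAut, ∃ l ∈ cs.cayleyLeftMul, ∃ d ∈ cs.cayleyDiagram, g = l * d) :
    cs.cayleyLeftMul.Normal := by
  rw [← Subgroup.normalizer_eq_top_iff, eq_top_iff]
  intro g _
  obtain ⟨l, hl, d, hd, rfl⟩ := h g
  exact mul_mem (Subgroup.le_normalizer hl) (cayleyDiagram_le_normalizer hd)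

/-- The induced subgroups are the images of the original ones under the isomorphism, so
factorizations transfer. -/
theorem forall_davisAut_exists_mul_iff [Finite B] :
    (∀ f : cs.DavisAut, ∃ l ∈ cs.davisLeftMul, ∃ d ∈ cs.davisDiagram, f = l * d) ↔
      ∀ g : cs.CayleyAut, ∃ l ∈ cs.cayleyLeftMul, ∃ d ∈ cs.cayleyDiagram, g = l * d := by
  rw [davisLeftMul, davisDiagram, inducedSubgroup_eq_map, inducedSubgroup_eq_map,
    davisAutEquiv.surjective.forall]
  simp only [Subgroup.mem_map, exists_exists_and_eq_and, MulEquiv.coe_toMonoidHom, ← map_mul,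
    davisAutEquiv.injective.eq_iff]

theorem normal_and_isComplement'_iff [Finite B] :
    (cs.davisLeftMul.Normal ∧ Subgroup.IsComplement' cs.davisLeftMul cs.davisDiagram) ↔
      ¬ M.IsFlexible := by
  constructor
  · rintro ⟨-, hc⟩
    rw [← forall_exists_mul_iff (cs := cs), ← forall_davisAut_exists_mul_iff]
    intro f
    obtain ⟨⟨l, d⟩, e⟩ := hc.2 f
    exact ⟨l, l.2, d, d.2, e.symm⟩
  · intro hM
    have h1 := (forall_exists_mul_iff (cs := cs)).2 hM
    have h2 := forall_davisAut_exists_mul_iff.2 h1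
    refine ⟨?_, ?_⟩
    · rw [davisLeftMul, inducedSubgroup_eq_map]
      exact (normal_cayleyLeftMul h1).map _ davisAutEquiv.surjective
    · refine Subgroup.isComplement'_of_disjoint_and_mul_eq_univ ?_ ?_
      · rw [davisLeftMul, davisDiagram, inducedSubgroup_eq_map, inducedSubgroup_eq_map]
        exact Subgroup.disjoint_map davisAutEquiv.injective disjoint_cayleyLeftMul_cayleyDiagram
      · refine Set.eq_univ_of_forall fun f => ?_
        obtain ⟨l, hl, d, hd, rfl⟩ := h2 f
        exact Set.mul_mem_mul hl hd

end CoxeterSystem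

theorem proposition3p14 {B W : Type*} [Finite B] [Group W] {M : CoxeterMatrix B}
    (cs : CoxeterSystem M W) :
    -- every automorphism of the Cayley graph induces one of the Davis complex, and this is
    -- an isomorphism of the automorphism groups
    (∃ Θ : cs.CayleyAut ≃* cs.DavisAut, ∀ g, CoxeterSystem.Induces g (Θ g)) ∧
    -- compositions of left-multiplication and diagram automorphisms
    ((∀ f : cs.DavisAut, ∃ l ∈ cs.davisLeftMul, ∃ d ∈ cs.davisDiagram, f = l * d) ↔
      ¬ M.IsFlexible) ∧
    -- discreteness
    (DiscreteTopology cs.DavisAut ↔ ¬ M.IsFlexible) ∧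
    -- the (internal) semidirect product
    (¬ M.IsFlexible ↔
      cs.davisLeftMul.Normal ∧ Subgroup.IsComplement' cs.davisLeftMul cs.davisDiagram) := by
  refine ⟨⟨CoxeterSystem.davisAutEquiv, CoxeterSystem.induces_davisAutEquiv⟩,
    CoxeterSystem.forall_davisAut_exists_mul_iff.trans CoxeterSystem.forall_exists_mul_iff,
    ⟨fun hd hM => CoxeterSystem.isFlexible_imp_not_discreteTopology hM hd,
      CoxeterSystem.discreteTopology_of_not_isFlexible⟩,
    CoxeterSystem.normal_and_isComplement'_iff.symm⟩
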